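/- Let $\mathbb T=\mathbb R/2\pi\mathbb Z$ carry the normalized measure $\frac{dx}{2\pi}$; functions on $\mathbb T$ are real or complex valued, $\|f\|_p$ $(1\le p\le\infty)$ is the $L^p$-norm for this measure, and $(f_1*f_2)(x)=\frac1{2\pi}\int_{\mathbb T}f_1(t)f_2(x-t)\,dt$. For a function $\lambda:\mathbb R\to\mathbb R$ with $\sum_{k\in\mathbb Z}|\lambda(k)|<\infty$ put $\varphi_\lambda(x)=\sum_{k\in\mathbb Z}\lambda(k)e^{ikx}$. If moreover $\lambda$ has no zeros, let $$\mathcal H_{\lambda,p}=\{f=\varphi_\lambda*g:\ g\in L^p(\mathbb T)\},\qquad \|f\|_{\mathcal H_{\lambda,p}}=\|g\|_p\quad\text{for } f=\varphi_\lambda*g .$$ A function $\lambda:\mathbb R\to\mathbb R$ is a *mask of type* $(r,\kappa)$ if it is even and twice continuously differentiable and there are $F:\mathbb R\to\mathbb R$ and a constant $a_1$ such that $\lambda(t)=|t|^{-r}(\log(|t|+1))^{-\kappa}F(\log|t|)$ for $t\ge1$ and $|F^{(k)}(t)|\le a_1$ for all $t\ge1$ and $k=0,1,2$. A function $\beta:\mathbb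 R\to\mathbb R$ is *of exponent type* if there are $s>0$ and a decreasing (not necessarily strictly) function $F:[0,\infty)\to(0,\infty)$ with $\beta(t)=e^{-s|t|}F(|t|)$ for all $t\in\mathbb R$. Let $\vartheta:\mathbb R\to\mathbb R$ be twice continuously differentiable with $\vartheta=1$ on $[-\frac12,\frac12]$ and $\vartheta=0$ outside $(-1,1)$. For $m\in\mathbb N=\{1,2,\dots\}$ and $f=\varphi_\lambda*g\in\mathcal H_{\lambda,p}$ put $$H_m(x)=\sum_{k\in\mathbb Z}\vartheta\Big(\frac km\Big)\frac{\lambda(k)}{\beta(k)}e^{ikx},\qquad V_m(g)=H_m*g,$$ $$Q_{m,\beta}(f)=\frac1{2m+1}\sum_{k=0}^{2m}V_m(g)\Big(\frac{2\pi k}{2m+1}\Big)\,\varphi_\beta\Big(\cdot-\frac{2\pi k}{2m+1}\Big).$$ **Theorem.** Let $1\le p\le\infty$, $1<r<\infty$, $\kappa\in\mathbb Z$, let $\vartheta$ be as above, let $\lambda:\mathbb R\to\mathbb R\setminus\{0\}$ be a mask of type $(r,\kappa)$, and let $\beta$ be of exponent type. Then there is a constant $c>0$ such that for all $f\in\mathcal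 H_{\lambda,p}$ and all $m\in\mathbb N$, $$\|f-Q_{m,\beta}(f)\|_p\le c\,m^{-r}(\log(m+1))^{-\kappa}\,\|f\|_{\mathcal H_{\lambda,p}} .$$ -/

import Mathlib

open MeasureTheory
open scoped ENNReal

noncomputable section

namespace TranslateApprox

instance instFactTwoPiPos : Fact (0 < 2 * Real.pi) := ⟨Real.two_pi_pos⟩

/-- The torus: functions on it are the `2π`-periodic functions. -/
abbrev Torus : Type := AddCircle (2 * Real.pi)

/-- The normalized measure `dx / (2π)` on the torus. With it, `eLpNorm f p haar` is the norm
`(2π)^{-1/p} (∫ |f|^p dx)^{1/p}` (the essential supremum of `|f|` for `p = ∞`). -/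
abbrev haar : Measure Torus := AddCircle.haarAddCircle

/-- The convolution `(f * g)(x) = (1/2π) ∫ f(t) g(x - t) dt` on the torus. -/
def conv (f g : Torus → ℂ) : Torus → ℂ :=
  convolution f g (ContinuousLinearMap.mul ℂ ℂ) haar

/-- `φ_lam(x) = ∑_{k ∈ ℤ} lam(k) e^{ikx}`. -/
def phi (lam : ℝ → ℝ) (x : Torus) : ℂ :=
  ∑' k : ℤ, ((lam (k : ℝ) : ℝ) : ℂ) * fourier k x

/-- `f` is represented as `φ_lam * g` with `g ∈ L^p`. -/
def Represents (lam : ℝ → ℝ) (p : ℝ≥0∞) (f g : Torus → ℂ) : Prop :=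
  MemLp g p haar ∧ f =ᵐ[haar] conv (phi lam) g

/-- The space `H_{lam,p}` of all `φ_lam * g` with `g ∈ L^p`. -/
def HSpace (lam : ℝ → ℝ) (p : ℝ≥0∞) : Set (Torus → ℂ) :=
  {f | ∃ g, Represents lam p f g}

open Classical in
/-- The function `g ∈ L^p` with `f = φ_lam * g`; by `Represents.ae_eq` below it is unique up to
null sets when `lam` has no zeros and `lam(k)` is summable. (Outside `HSpace lam p` it is `0`.) -/
def generator (lam : ℝ → ℝ) (p : ℝ≥0∞) (f : Torus → ℂ) : Torus → ℂ :=
  if h : ∃ g, Represents lam p f g then h.choose else 0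

/-- The norm `‖f‖_{H_{lam,p}} = ‖g‖_p` for `f = φ_lam * g`. -/
def HNorm (lam : ℝ → ℝ) (p : ℝ≥0∞) (f : Torus → ℂ) : ℝ≥0∞ :=
  eLpNorm (generator lam p f) p haar

/-- A `C²` cut-off function, equal to `1` on `[-1/2, 1/2]` and to `0` outside `(-1, 1)`. -/
def IsCutoff (vth : ℝ → ℝ) : Prop :=
  ContDiff ℝ 2 vth ∧ (∀ x ∈ Set.Icc (-(1 / 2) : ℝ) (1 / 2), vth x = 1) ∧
    ∀ x ∉ Set.Ioo (-1 : ℝ) 1, vth x = 0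

/-- `H_m(x) = ∑_{k ∈ ℤ} vth(k/m) (lam(k)/beta(k)) e^{ikx}`. -/
def kernelH (vth lam beta : ℝ → ℝ) (m : ℕ) (x : Torus) : ℂ :=
  ∑' k : ℤ, ((vth ((k : ℝ) / (m : ℝ)) * (lam (k : ℝ) / beta (k : ℝ)) : ℝ) : ℂ) * fourier k x

/-- `V_m(g) = H_m * g`. -/
def opV (vth lam beta : ℝ → ℝ) (m : ℕ) (g : Torus → ℂ) : Torus → ℂ :=
  conv (kernelH vth lam beta m) g

/-- The node `2πk/(2m+1)` of the torus. -/
def node (m k : ℕ) : Torus :=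
  ((2 * Real.pi * (k : ℝ) / (2 * (m : ℝ) + 1) : ℝ) : Torus)

/-- The operator `Q_{m,beta}` in terms of `g`, where `f = φ_lam * g`. -/
def opQGen (vth lam beta : ℝ → ℝ) (m : ℕ) (g : Torus → ℂ) (x : Torus) : ℂ :=
  (1 / (2 * (m : ℂ) + 1)) * ∑ k ∈ Finset.range (2 * m + 1),
    opV vth lam beta m g (node m k) * phi beta (x - node m k)

/-- The operator `Q_{m,beta}` on `H_{lam,p}`:
`Q_{m,beta}(f) = (2m+1)⁻¹ ∑_{k=0}^{2m} V_m(g)(2πk/(2m+1)) φ_beta(· - 2πk/(2m+1))`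
for `f = φ_lam * g`. -/
def opQ (vth lam beta : ℝ → ℝ) (p : ℝ≥0∞) (m : ℕ) (f : Torus → ℂ) : Torus → ℂ :=
  opQGen vth lam beta m (generator lam p f)

/-- Masks of type `(r, κ)`. The derivatives of `F` at the points `t ≥ 1` are genuine: the formula
for `f` makes `F` twice continuously differentiable on `(0, ∞)`. -/
def IsMask (r κ : ℝ) (f : ℝ → ℝ) : Prop :=
  (∀ t, f (-t) = f t) ∧ ContDiff ℝ 2 f ∧
    ∃ F : ℝ → ℝ, ∃ a : ℝ,
      (∀ t : ℝ, 1 ≤ t → f t = |t| ^ (-r) * Real.log (|t| + 1) ^ (-κ) * F (Real.log |t|)) ∧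
      ∀ t : ℝ, 1 ≤ t → ∀ k : ℕ, k ≤ 2 → |iteratedDeriv k F t| ≤ a

/-- Functions of exponent type: `f(t) = e^{-s|t|} F(|t|)` with `s > 0` and a positive decreasing
function `F` on `[0, ∞)`. No smoothness is asked for: such an `f` is never differentiable at `0`. -/
def IsExponentType (f : ℝ → ℝ) : Prop :=
  ∃ s : ℝ, 0 < s ∧ ∃ F : ℝ → ℝ,
    (∀ t, 0 ≤ t → 0 < F t) ∧ AntitoneOn F (Set.Ici 0) ∧
      ∀ t, f t = Real.exp (-(s * |t|)) * F |t|

/-! Uniqueness of the generator. -/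

theorem norm_fourier_apply (n : ℤ) (x : Torus) : ‖fourier n x‖ = 1 := by
  rw [fourier_apply]
  exact Circle.norm_coe _

theorem summable_phi {lam : ℝ → ℝ} (h : Summable fun k : ℤ => lam (k : ℝ)) (x : Torus) :
    Summable fun k : ℤ => ((lam (k : ℝ) : ℝ) : ℂ) * fourier k x := by
  refine Summable.of_norm ?_
  simpa only [norm_mul, norm_fourier_apply, mul_one, Complex.norm_real] using h.norm

theorem continuous_phi {lam : ℝ → ℝ} (h : Summable fun k : ℤ => lam (k : ℝ)) :
    Continuous (phi lam) := by
  unfold phi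
  refine continuous_tsum (u := fun k : ℤ => |lam (k : ℝ)|) (fun k => by fun_prop) h.abs ?_
  intro k x
  rw [norm_mul, norm_fourier_apply, mul_one, Complex.norm_real, Real.norm_eq_abs]

theorem integrable_of_continuous {f : Torus → ℂ} (hf : Continuous f) : Integrable f haar :=
  hf.integrable_of_hasCompactSupport (HasCompactSupport.of_compactSpace f)

theorem fourierCoeff_phi {lam : ℝ → ℝ} (h : Summable fun k : ℤ => lam (k : ℝ)) (n : ℤ) :
    fourierCoeff (phi lam) n = ((lam (n : ℝ) : ℝ) : ℂ) := by
  have h1 : HasSum (fun k : ℤ => ∫ x : Torus, fourier (-n) x •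
      (((lam (k : ℝ) : ℝ) : ℂ) * fourier k x) ∂haar)
      (∫ x : Torus, ∑' k : ℤ, fourier (-n) x • (((lam (k : ℝ) : ℝ) : ℂ) * fourier k x) ∂haar) := by
    refine hasSum_integral_of_summable_integral_norm
      (fun k => integrable_of_continuous (by fun_prop)) ?_
    simpa [-fourier_apply, norm_fourier_apply] using h.abs
  have h2 : ∀ k : ℤ, ∫ x : Torus, fourier (-n) x •
      (((lam (k : ℝ) : ℝ) : ℂ) * fourier k x) ∂haar = if k = n then ((lam (n : ℝ) : ℝ) : ℂ) else 0 := by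
    intro k
    have h3 := fourierCoeff.const_mul (T := 2 * Real.pi) (fun x => fourier k x)
      ((lam (k : ℝ) : ℝ) : ℂ) n
    have h4 := congrFun (fourierCoeff_fourier (T := 2 * Real.pi) k) n
    rw [fourierCoeff] at h3
    rw [h3]
    erw [h4]
    by_cases hk : k = n
    · subst hk; simp
    · simp [hk, Ne.symm hk]
  rw [fourierCoeff]
  simp only [h2] at h1
  have h5 := h1.unique (hasSum_ite_eq n _)
  rw [← h5]
  congr 1
  ext x
  rw [phi, smul_eq_mul, ← tsum_mul_left]
  rfl

theorem fourierCoeff_conv {f g : Torus → ℂ} (hf : Integrable f haar) (hg : Integrable g haar)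
    (n : ℤ) : fourierCoeff (conv f g) n = fourierCoeff f n * fourierCoeff g n := by
  have h := integral_convolution (μ := haar) (ν := haar) (ContinuousLinearMap.mul ℂ ℂ)
    (hf.fourier_smul (-n)) (hg.fourier_smul (-n))
  simp only [ContinuousLinearMap.mul_apply'] at h
  rw [fourierCoeff, fourierCoeff, fourierCoeff, ← h]
  congr 1
  ext x
  rw [conv, convolution, convolution, smul_eq_mul, ← integral_const_mul]
  congr 1
  ext t
  have : fourier (-n) x = fourier (-n) t * fourier (-n) (x - t) := by
    simp only [fourier_apply]
    rw [← Circle.coe_mul, ← AddCircle.toCircle_add, ← smul_add, add_sub_cancel]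
  simp only [ContinuousLinearMap.mul_apply', smul_eq_mul, this]
  ring

theorem ae_eq_zero_of_fourierCoeff {g : Torus → ℂ} (hg : Integrable g haar)
    (h : ∀ n, fourierCoeff g n = 0) : g =ᵐ[haar] 0 := by
  have hi : ∀ f : C(Torus, ℂ), Integrable (fun x => f x * g x) haar := fun f =>
    hg.bdd_mul (c := ‖f‖) f.continuous.aestronglyMeasurable
      (Filter.Eventually.of_forall fun x => f.norm_coe_le_norm x)
  have hc : ∀ f : C(Torus, ℂ), ∫ x, f x * g x ∂haar = 0 := by
    let L : C(Torus, ℂ) →ₗ[ℂ] ℂ :=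
      { toFun := fun f => ∫ x, f x * g x ∂haar
        map_add' := fun f₁ f₂ => by
          rw [← integral_add (hi f₁) (hi f₂)]; simp [add_mul]
        map_smul' := fun c f => by
          simp only [ContinuousMap.smul_apply, smul_eq_mul, mul_assoc, RingHom.id_apply]
          rw [integral_const_mul] }
    have hL : Continuous L := by
      refine AddMonoidHomClass.continuous_of_bound L (∫ x, ‖g x‖ ∂haar) fun f => ?_
      calc ‖∫ x, f x * g x ∂haar‖ ≤ ∫ x, ‖f‖ * ‖g x‖ ∂haar := by
            refine norm_integral_le_of_norm_le (hg.norm.const_mul _)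
              (Filter.Eventually.of_forall fun x => ?_)
            rw [norm_mul]
            gcongr
            exact f.norm_coe_le_norm x
        _ = _ := by rw [integral_const_mul, mul_comm]
    have hs : (⊤ : Submodule ℂ C(Torus, ℂ)) ≤ LinearMap.ker L := by
      rw [← span_fourier_closure_eq_top]
      refine Submodule.topologicalClosure_minimal _ ?_ (isClosed_singleton.preimage hL)
      rw [Submodule.span_le]
      rintro _ ⟨n, rfl⟩
      have := h (-n)
      rw [fourierCoeff, neg_neg] at this
      exact this
    exact fun f => hs (Submodule.mem_top : f ∈ ⊤)
  refine ae_eq_zero_of_forall_setIntegral_isClosed_eq_zero hg fun s hs => ?_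
  have ht : Filter.Tendsto (fun n => ∫ x, (((hs.apprSeq n x : NNReal) : ℝ) : ℂ) * g x ∂haar)
      Filter.atTop (nhds (∫ x, (s.indicator (fun _ => (1 : ℂ)) x) * g x ∂haar)) := by
    refine tendsto_integral_of_dominated_convergence (fun x => ‖g x‖) ?_ hg.norm ?_ ?_
    · intro n
      have : Continuous fun x => (((hs.apprSeq n x : NNReal) : ℝ) : ℂ) :=
        Complex.continuous_ofReal.comp (NNReal.continuous_coe.comp (hs.apprSeq n).continuous)
      exact this.aestronglyMeasurable.mul hg.1
    · intro n
      refine Filter.Eventually.of_forall fun x => ?_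
      have h1 : (hs.apprSeq n x : NNReal) ≤ 1 := HasOuterApproxClosed.apprSeq_apply_le_one hs n x
      rw [norm_mul, Complex.norm_real, Real.norm_of_nonneg (NNReal.coe_nonneg _)]
      exact mul_le_of_le_one_left (norm_nonneg _) (by exact_mod_cast h1)
    · refine Filter.Eventually.of_forall fun x => ?_
      refine Filter.Tendsto.mul_const _ ?_
      have h1 := (tendsto_pi_nhds.1 (HasOuterApproxClosed.tendsto_apprSeq hs)) x
      have h2 := (Complex.continuous_ofReal.comp NNReal.continuous_coe).tendsto _ |>.comp h1
      refine h2.congr' ?_ |>.trans ?_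
      · exact Filter.EventuallyEq.rfl
      · by_cases hx : x ∈ s <;> simp [hx]
  have h0 : ∀ n, ∫ x, (((hs.apprSeq n x : NNReal) : ℝ) : ℂ) * g x ∂haar = 0 := fun n =>
    hc ⟨fun x => (((hs.apprSeq n x : NNReal) : ℝ) : ℂ),
      Complex.continuous_ofReal.comp (NNReal.continuous_coe.comp (hs.apprSeq n).continuous)⟩
  simp only [h0] at ht
  have h1 := tendsto_nhds_unique ht tendsto_const_nhds
  rw [← integral_indicator hs.measurableSet, ← h1]
  congr 1
  ext x
  by_cases hx : x ∈ s <;> simp [hx]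

/-- The generator of a function of `H_{lam,p}` is unique up to null sets. -/
theorem Represents.ae_eq {lam : ℝ → ℝ} {p : ℝ≥0∞} {f g₁ g₂ : Torus → ℂ} (hp : 1 ≤ p)
    (hs : Summable fun k : ℤ => lam (k : ℝ)) (h0 : ∀ x, lam x ≠ 0)
    (h₁ : Represents lam p f g₁) (h₂ : Represents lam p f g₂) : g₁ =ᵐ[haar] g₂ := by
  have i₁ := h₁.1.integrable hp
  have i₂ := h₂.1.integrable hp
  have hφ := integrable_of_continuous (continuous_phi hs)
  have hz : g₁ - g₂ =ᵐ[haar] 0 := by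
    refine ae_eq_zero_of_fourierCoeff (i₁.sub i₂) fun n => ?_
    have e := fourierCoeff_congr_ae (h₁.2.symm.trans h₂.2)
    have e := congrFun e n
    rw [fourierCoeff_conv hφ i₁, fourierCoeff_conv hφ i₂, fourierCoeff_phi hs] at e
    have e := mul_left_cancel₀ (Complex.ofReal_ne_zero.2 (h0 _)) e
    rw [fourierCoeff, fourierCoeff] at e
    rw [fourierCoeff]
    simp only [Pi.sub_apply, smul_sub]
    rw [integral_sub (i₁.fourier_smul _) (i₂.fourier_smul _), e, sub_self]
  filter_upwards [hz] with x hx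
  exact sub_eq_zero.1 hx

theorem represents_generator {lam : ℝ → ℝ} {p : ℝ≥0∞} {f : Torus → ℂ} (hf : f ∈ HSpace lam p) :
    Represents lam p f (generator lam p f) := by
  have hf' : ∃ g, Represents lam p f g := hf
  rw [generator, dif_pos hf']
  exact hf'.choose_spec

/-- The norm of `H_{lam,p}` may be computed from any representation. -/
theorem Represents.hNorm_eq {lam : ℝ → ℝ} {p : ℝ≥0∞} {f g : Torus → ℂ} (hp : 1 ≤ p)
    (hs : Summable fun k : ℤ => lam (k : ℝ)) (h0 : ∀ x, lam x ≠ 0)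
    (h : Represents lam p f g) : HNorm lam p f = eLpNorm g p haar :=
  eLpNorm_congr_ae ((represents_generator ⟨g, h⟩).ae_eq hp hs h0 h)

/-- The operator `Q_{m,beta}` may be computed from any representation. -/
theorem Represents.opQ_eq {lam : ℝ → ℝ} {p : ℝ≥0∞} {f g : Torus → ℂ} (vth beta : ℝ → ℝ) (m : ℕ)
    (hp : 1 ≤ p) (hs : Summable fun k : ℤ => lam (k : ℝ)) (h0 : ∀ x, lam x ≠ 0)
    (h : Represents lam p f g) : opQ vth lam beta p m f = opQGen vth lam beta m g := by
  have e := (represents_generator ⟨g, h⟩).ae_eq hp hs h0 h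
  have : opV vth lam beta m (generator lam p f) = opV vth lam beta m g := by
    rw [opV, opV, conv, conv]
    exact convolution_congr _ Filter.EventuallyEq.rfl e
  ext x
  rw [opQ, opQGen, opQGen, this]

end TranslateApprox

end

open MeasureTheory
open scoped ENNReal

noncomputable section

namespace TranslateApprox

/-! Write w(x) = x^(-r) log(x+1)^(-κ) for `maskWeight`, and split f = φ_λ * g into u, with
multiplier (1 - ϑ(k/m))λ(k) (`highPart`), and the trigonometric polynomial f - u with multiplier
ϑ(k/m)λ(k). Then f - Q_m f = u - R with R = Q_m f - (f - u), and both pieces are O(w(m)) ‖g‖_p.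

High frequencies: by Young's inequality (`eLpNorm_conv_le`) it is enough that the kernel of u has
L¹-norm O(w(m)). Bernstein's method (`integral_norm_phi_le`) reduces this to ℓ² bounds for the
multiplier and for m times its differences. Potter's bounds for w, with r > 1, make both O(w(m)
m/|k|) on the range |k| ≳ m outside which they vanish, so their sums of squares are O(w(m)² m)
(`exists_sq_sum_highPart_le`).

Aliasing: Q_m replaces e^{ijx} by (ϑ(j/m)λ(j)/β(j)) ∑_l β(j + l(2m+1)) e^{i(j+l(2m+1))x}
(`sample_eq_tsum`). The term l = 0 reproduces f - u exactly. The others are smaller than β(j) by a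
factor O(e^{-2s(m-|j|)}), so β cancels and no lower bound for it is needed. The sum ∑_{|j|≤m} |λ(j)|
e^{-2s(m-|j|)} is concentrated near |j| = m, hence O(w(m)) (`IsMask.exists_sum_exp_le`). This bounds
R in the sup norm by O(w(m)) ‖g‖_1, and ‖g‖_1 ≤ ‖g‖_p. -/

/-! ### Young's inequality on the torus. -/

theorem conv_apply (f g : Torus → ℂ) (x : Torus) : conv f g x = ∫ t, f t * g (x - t) ∂haar := rfl

theorem enorm_conv_le (K g : Torus → ℂ) (x : Torus) :
    ‖conv K g x‖ₑ ≤ ∫⁻ t, ‖K t‖ₑ * ‖g (x - t)‖ₑ ∂haar := by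
  rw [conv_apply]
  refine (enorm_integral_le_lintegral_enorm _).trans_eq ?_
  simp only [enorm_mul]

/-- Jensen's inequality for the weight `‖K‖ₑ`, in Hölder form. -/
theorem lintegral_mul_le_rpow {α : Type*} [MeasurableSpace α] {μ : Measure α} {q : ℝ} (hq : 1 ≤ q)
    {K h : α → ℝ≥0∞} (hK : AEMeasurable K μ) (hh : AEMeasurable h μ) (hK' : ∀ t, K t ≠ ∞) :
    (∫⁻ t, K t * h t ∂μ) ≤
      (∫⁻ t, K t * h t ^ q ∂μ) ^ (1 / q) * (∫⁻ t, K t ∂μ) ^ (1 - 1 / q) := by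
  have hq0 : 0 < q := by linarith
  have h1 : 1 / q ≤ 1 := by rw [div_le_one hq0]; exact hq
  refine le_trans (le_of_eq ?_) (ENNReal.lintegral_mul_norm_pow_le
    (f := fun t => K t * h t ^ q) (g := K) (p := 1 / q) (q := 1 - 1 / q)
    (hK.mul (hh.pow_const q)) hK (by positivity) (by linarith) (by ring))
  refine lintegral_congr fun t => ?_
  rw [ENNReal.mul_rpow_of_nonneg _ _ (by positivity : 0 ≤ 1 / q), ← ENNReal.rpow_mul,
    mul_one_div_cancel hq0.ne', ENNReal.rpow_one]
  rcases eq_or_ne (K t) 0 with h0 | h0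
  · rw [h0, zero_mul]
    rw [ENNReal.zero_rpow_of_pos (by positivity)]
    simp
  · calc K t * h t = K t ^ (1 / q + (1 - 1 / q)) * h t := by
          rw [add_sub_cancel, ENNReal.rpow_one]
      _ = _ := by rw [ENNReal.rpow_add _ _ h0 (hK' t)]; ring

/-- Young's inequality for the convolution with a continuous kernel. -/
theorem eLpNorm_conv_le {p : ℝ≥0∞} (hp : 1 ≤ p) {K g : Torus → ℂ} (hK : Continuous K)
    (hg : AEStronglyMeasurable g haar) :
    eLpNorm (conv K g) p haar ≤ (∫⁻ t, ‖K t‖ₑ ∂haar) * eLpNorm g p haar := by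
  -- Both sides depend only on the class of `g`; a measurable representative gives the joint
  -- measurability needed for Tonelli.
  wlog hgm : StronglyMeasurable g generalizing g
  · have e : conv K g = conv K (hg.mk g) :=
      convolution_congr _ Filter.EventuallyEq.rfl hg.ae_eq_mk
    rw [e, eLpNorm_congr_ae hg.ae_eq_mk]
    exact this hg.stronglyMeasurable_mk.aestronglyMeasurable hg.stronglyMeasurable_mk
  have hKm : Measurable fun t => ‖K t‖ₑ := hK.measurable.enorm
  have hgx : ∀ x, Measurable fun t => ‖g (x - t)‖ₑ := fun x =>
    (hgm.measurable.comp (measurable_const.sub measurable_id)).enorm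
  rcases eq_or_ne p ∞ with rfl | hpt
  · rw [eLpNorm_exponent_top, eLpNorm_exponent_top]
    refine essSup_le_of_ae_le _ (Filter.Eventually.of_forall fun x => ?_)
    refine (enorm_conv_le K g x).trans ?_
    rw [← lintegral_mul_const _ hKm]
    refine lintegral_mono_ae ?_
    have h1 : ∀ᵐ t ∂haar, ‖g t‖ₑ ≤ eLpNormEssSup g haar := ae_le_eLpNormEssSup
    have h2 := (Measure.measurePreserving_sub_left haar x).quasiMeasurePreserving.ae h1
    filter_upwards [h2] with t ht
    gcongr
  · have hp0 : p ≠ 0 := (zero_lt_one.trans_le hp).ne'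
    set q := p.toReal with hq
    have hq1 : 1 ≤ q := by
      rw [hq, ← ENNReal.toReal_one]
      exact ENNReal.toReal_mono hpt hp
    have hq0 : 0 < q := by linarith
    rw [eLpNorm_eq_lintegral_rpow_enorm_toReal hp0 hpt,
      eLpNorm_eq_lintegral_rpow_enorm_toReal hp0 hpt, ← hq]
    set A := ∫⁻ t, ‖K t‖ₑ ∂haar with hA
    have hj : ∀ x, ‖conv K g x‖ₑ ^ q ≤
        (∫⁻ t, ‖K t‖ₑ * ‖g (x - t)‖ₑ ^ q ∂haar) * A ^ (q - 1) := by
      intro x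
      have h1 := (enorm_conv_le K g x).trans
        (lintegral_mul_le_rpow hq1 hKm.aemeasurable (hgx x).aemeasurable fun t => enorm_ne_top)
      refine (ENNReal.rpow_le_rpow h1 hq0.le).trans_eq ?_
      rw [ENNReal.mul_rpow_of_nonneg _ _ hq0.le, ← ENNReal.rpow_mul, ← ENNReal.rpow_mul,
        one_div_mul_cancel hq0.ne', ENNReal.rpow_one, sub_mul, one_div_mul_cancel hq0.ne', one_mul]
    have hm : Measurable fun z : Torus × Torus => ‖K z.2‖ₑ * ‖g (z.1 - z.2)‖ₑ ^ q :=
      (hKm.comp measurable_snd).mul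
        ((hgm.measurable.comp (measurable_fst.sub measurable_snd)).enorm.pow_const q)
    have hi : (∫⁻ x, ‖conv K g x‖ₑ ^ q ∂haar) ≤ A ^ q * ∫⁻ x, ‖g x‖ₑ ^ q ∂haar := by
      calc (∫⁻ x, ‖conv K g x‖ₑ ^ q ∂haar)
          ≤ ∫⁻ x, (∫⁻ t, ‖K t‖ₑ * ‖g (x - t)‖ₑ ^ q ∂haar) * A ^ (q - 1) ∂haar :=
            lintegral_mono hj
        _ = (∫⁻ x, ∫⁻ t, ‖K t‖ₑ * ‖g (x - t)‖ₑ ^ q ∂haar ∂haar) * A ^ (q - 1) :=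
            lintegral_mul_const _ hm.lintegral_prod_right'
        _ = (∫⁻ t, ∫⁻ x, ‖K t‖ₑ * ‖g (x - t)‖ₑ ^ q ∂haar ∂haar) * A ^ (q - 1) := by
            rw [lintegral_lintegral_swap hm.aemeasurable]
        _ = (∫⁻ t, ‖K t‖ₑ * ∫⁻ x, ‖g x‖ₑ ^ q ∂haar ∂haar) * A ^ (q - 1) := by
            congr 1
            refine lintegral_congr fun t => ?_
            rw [lintegral_const_mul' _ _ enorm_ne_top]
            rw [lintegral_sub_right_eq_self (fun x => ‖g x‖ₑ ^ q) t]
        _ = A ^ q * ∫⁻ x, ‖g x‖ₑ ^ q ∂haar := by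
            rw [lintegral_mul_const _ hKm, ← hA]
            have : A ^ q = A * A ^ (q - 1) := by
              nth_rewrite 2 [← ENNReal.rpow_one A]
              rw [← ENNReal.rpow_add_of_nonneg _ _ zero_le_one (by linarith), add_sub_cancel]
            rw [this]; ring
    refine (ENNReal.rpow_le_rpow hi (by positivity : 0 ≤ 1 / q)).trans_eq ?_
    rw [ENNReal.mul_rpow_of_nonneg _ _ (by positivity), ← ENNReal.rpow_mul,
      mul_one_div_cancel hq0.ne', ENNReal.rpow_one]

/-! ### Multiplier series and Parseval's identity. -/

theorem norm_fourierCoeff_le {g : Torus → ℂ} (n : ℤ) :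
    ‖fourierCoeff g n‖ ≤ ∫ x, ‖g x‖ ∂haar := by
  rw [fourierCoeff]
  refine (norm_integral_le_integral_norm _).trans_eq ?_
  simp only [norm_smul, norm_fourier_apply, one_mul]

theorem fourier_sub_apply (n : ℤ) (x y : Torus) :
    fourier n (x - y) = fourier n x * fourier (-n) y := by
  simp only [fourier_apply]
  rw [← Circle.coe_mul, ← AddCircle.toCircle_add, smul_sub, neg_smul, sub_eq_add_neg]

theorem conv_fourier (k : ℤ) (g : Torus → ℂ) (x : Torus) :
    ∫ t, fourier k t * g (x - t) ∂haar = fourierCoeff g k * fourier k x := by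
  have h := integral_sub_left_eq_self (fun t => fourier k (x - t) * g t) haar x
  simp only [sub_sub_cancel] at h
  rw [h, fourierCoeff, ← integral_mul_const]
  refine integral_congr_ae (Filter.Eventually.of_forall fun t => ?_)
  simp only [fourier_sub_apply, smul_eq_mul]
  ring

theorem summable_series {mu : ℝ → ℝ} (h : Summable fun k : ℤ => mu (k : ℝ)) (g : Torus → ℂ)
    (x : Torus) :
    Summable fun k : ℤ => ((mu (k : ℝ) : ℝ) : ℂ) * fourierCoeff g k * fourier k x := by
  refine Summable.of_norm_bounded (h.abs.mul_right (∫ x, ‖g x‖ ∂haar)) fun k => ?_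
  rw [norm_mul, norm_mul, norm_fourier_apply, mul_one, Complex.norm_real, Real.norm_eq_abs]
  gcongr
  exact norm_fourierCoeff_le k

/-- The convolution with `φ_mu` is the multiplier operator with the coefficients `mu(k)`. -/
theorem conv_phi {mu : ℝ → ℝ} (h : Summable fun k : ℤ => mu (k : ℝ)) {g : Torus → ℂ}
    (hg : Integrable g haar) (x : Torus) :
    conv (phi mu) g x = ∑' k : ℤ, ((mu (k : ℝ) : ℝ) : ℂ) * fourierCoeff g k * fourier k x := by
  have hgx : Integrable (fun t => g (x - t)) haar := hg.comp_sub_left x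
  have h1 : HasSum (fun k : ℤ => ∫ t : Torus,
      ((mu (k : ℝ) : ℝ) : ℂ) * fourier k t * g (x - t) ∂haar)
      (∫ t : Torus, ∑' k : ℤ, ((mu (k : ℝ) : ℝ) : ℂ) * fourier k t * g (x - t) ∂haar) := by
    refine hasSum_integral_of_summable_integral_norm (fun k => ?_) ?_
    · simp only [mul_assoc]
      refine Integrable.const_mul ?_ _
      exact hgx.bdd_mul (c := 1) (fourier k).continuous.aestronglyMeasurable
        (Filter.Eventually.of_forall fun t => (norm_fourier_apply k t).le)
    · simp only [norm_mul, norm_fourier_apply, mul_one, integral_const_mul]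
      exact (by simpa using h.norm : Summable fun k : ℤ => ‖((mu (k : ℝ) : ℝ) : ℂ)‖).mul_right _
  rw [conv_apply]
  have h2 : ∀ t, phi mu t * g (x - t) =
      ∑' k : ℤ, ((mu (k : ℝ) : ℝ) : ℂ) * fourier k t * g (x - t) := fun t => by
    rw [tsum_mul_right, phi]
  simp only [h2]
  rw [← h1.tsum_eq]
  refine tsum_congr fun k => ?_
  simp only [mul_assoc, integral_const_mul, conv_fourier]

theorem continuous_conv_phi {mu : ℝ → ℝ} (h : Summable fun k : ℤ => mu (k : ℝ)) {g : Torus → ℂ}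
    (hg : Integrable g haar) : Continuous (conv (phi mu) g) := by
  rw [funext fun x => conv_phi h hg x]
  refine continuous_tsum (u := fun k : ℤ => |mu (k : ℝ)| * ∫ x, ‖g x‖ ∂haar)
    (fun k => by fun_prop) (h.abs.mul_right _) ?_
  intro k x
  rw [norm_mul, norm_mul, norm_fourier_apply, mul_one, Complex.norm_real, Real.norm_eq_abs]
  gcongr
  exact norm_fourierCoeff_le k

/-- Parseval's identity for `φ_mu`. -/
theorem integral_norm_sq_phi {mu : ℝ → ℝ} (h : Summable fun k : ℤ => mu (k : ℝ)) :
    ∫ x, ‖phi mu x‖ ^ 2 ∂haar = ∑' k : ℤ, mu (k : ℝ) ^ 2 := by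
  let F : C(Torus, ℂ) := ⟨phi mu, continuous_phi h⟩
  have h1 := tsum_sq_fourierCoeff (ContinuousMap.toLp (E := ℂ) 2 haar ℂ F)
  have h2 : ∫ x, ‖phi mu x‖ ^ 2 ∂haar =
      ∫ t, ‖(ContinuousMap.toLp (E := ℂ) 2 haar ℂ F : Lp ℂ 2 haar) t‖ ^ 2 ∂haar := by
    refine integral_congr_ae ?_
    filter_upwards [ContinuousMap.coeFn_toLp (E := ℂ) (p := 2) (𝕜 := ℂ) haar F] with t ht
    rw [ht]; rfl
  rw [h2, ← h1]
  refine tsum_congr fun k => ?_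
  rw [fourierCoeff_toLp]
  have : fourierCoeff (⇑F) k = ((mu (k : ℝ) : ℝ) : ℂ) := fourierCoeff_phi h k
  rw [this, Complex.norm_real, Real.norm_eq_abs, sq_abs]

/-! ### Bernstein's bound for the L¹-norm of a kernel. -/

theorem summable_comp_sub_one {mu : ℝ → ℝ} (h : Summable fun k : ℤ => mu (k : ℝ)) :
    Summable fun k : ℤ => mu ((k : ℝ) - 1) := by
  refine ((Equiv.subRight (1 : ℤ)).summable_iff.2 h).congr fun k => ?_
  simp

/-- Multiplying by e^{ix} shifts the coefficients by one. Through this identity, small differences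
of the coefficients become decay of the kernel away from 0. -/
theorem one_sub_fourier_mul_phi {mu : ℝ → ℝ} (h : Summable fun k : ℤ => mu (k : ℝ)) (x : Torus) :
    (1 - fourier 1 x) * phi mu x = phi (fun t => mu t - mu (t - 1)) x := by
  have h1 : fourier 1 x * phi mu x =
      ∑' k : ℤ, ((mu ((k : ℝ) - 1) : ℝ) : ℂ) * fourier k x := by
    rw [phi, ← tsum_mul_left, ← (Equiv.subRight (1 : ℤ)).tsum_eq]
    refine tsum_congr fun k => ?_
    have : fourier k x = fourier (k - 1) x * fourier 1 x := by
      rw [← fourier_add, sub_add_cancel]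
    simp only [Equiv.subRight_apply]
    rw [this]
    push_cast
    ring
  have h' := summable_comp_sub_one h
  rw [sub_mul, one_mul, h1, phi, phi, ← (summable_phi h x).tsum_sub
    (summable_phi (lam := fun t => mu (t - 1)) h' x)]
  refine tsum_congr fun k => ?_
  push_cast
  ring

/-- Jordan's inequality for the sine, since |1 - e^{ix}| = 2|sin(x/2)|. -/
theorem norm_one_sub_fourier_ge {x : ℝ} (hx : |x| ≤ Real.pi) :
    2 / Real.pi * |x| ≤ ‖1 - fourier 1 (x : Torus)‖ := by
  have h1 : fourier 1 (x : Torus) = Complex.exp (x * Complex.I) := by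
    rw [fourier_coe_apply]
    congr 1
    have : (Real.pi : ℂ) ≠ 0 := by exact_mod_cast Real.pi_ne_zero
    push_cast
    field_simp
  have h2 : ‖1 - fourier 1 (x : Torus)‖ = 2 * |Real.sin (x / 2)| := by
    rw [h1, norm_sub_rev, mul_comm, Complex.norm_exp_I_mul_ofReal_sub_one, norm_mul,
      Real.norm_eq_abs, Real.norm_eq_abs]
    norm_num
  rw [h2]
  have h3 := Real.mul_abs_le_abs_sin (x := x / 2) (by
    rw [abs_div, abs_two]; linarith)
  rw [abs_div, abs_two] at h3
  linarith

/-- The weight used to pass from `L²` to `L¹`. -/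
def l1Weight (N : ℝ) (x : Torus) : ℝ := 1 + N ^ 2 * ‖1 - fourier 1 x‖ ^ 2

theorem one_le_l1Weight (N : ℝ) (x : Torus) : 1 ≤ l1Weight N x := by
  rw [l1Weight]; nlinarith [sq_nonneg (N * ‖1 - fourier 1 x‖)]

theorem continuous_l1Weight (N : ℝ) : Continuous (l1Weight N) := by
  unfold l1Weight
  fun_prop

/-- On [-π, π] the weight dominates 1 + (bx)² with b = 2N/π, whose reciprocal has integral π/b over
the whole line. -/
theorem integral_inv_l1Weight_le {N : ℝ} (hN : 0 < N) :
    ∫ x, (l1Weight N x)⁻¹ ∂haar ≤ Real.pi / N := by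
  have hc : Continuous fun x => (l1Weight N x)⁻¹ :=
    (continuous_l1Weight N).inv₀ fun x => (zero_lt_one.trans_le (one_le_l1Weight N x)).ne'
  rw [AddCircle.integral_haarAddCircle, ← AddCircle.integral_preimage (2 * Real.pi) (-Real.pi)]
  have hpi := Real.pi_pos
  set b := 2 * N / Real.pi with hb
  have hb0 : 0 < b := by positivity
  have hint : Integrable (fun x : ℝ => (1 + (b * x) ^ 2)⁻¹) :=
    integrable_inv_one_add_sq.comp_mul_left' hb0.ne'
  have h1 : ∫ a in Set.Ioc (-Real.pi) (-Real.pi + 2 * Real.pi), (l1Weight N (a : Torus))⁻¹ ≤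
      ∫ a in Set.Ioc (-Real.pi) (-Real.pi + 2 * Real.pi), (1 + (b * a) ^ 2)⁻¹ := by
    refine setIntegral_mono_on ?_ hint.integrableOn measurableSet_Ioc ?_
    · have : Continuous fun a : ℝ => (l1Weight N (a : Torus))⁻¹ :=
        hc.comp (AddCircle.continuous_mk' _)
      exact (this.integrableOn_Icc (a := -Real.pi) (b := -Real.pi + 2 * Real.pi)).mono_set
        Set.Ioc_subset_Icc_self
    · intro a ha
      have ha' : |a| ≤ Real.pi := abs_le.2 ⟨ha.1.le, by linarith [ha.2]⟩
      have h2 := norm_one_sub_fourier_ge ha'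
      have h3 : b * |a| ≤ N * ‖1 - fourier 1 (a : Torus)‖ := by
        calc b * |a| = N * (2 / Real.pi * |a|) := by rw [hb]; ring
          _ ≤ _ := by gcongr
      have h4 : (b * a) ^ 2 ≤ N ^ 2 * ‖1 - fourier 1 (a : Torus)‖ ^ 2 := by
        calc (b * a) ^ 2 = (b * |a|) ^ 2 := by rw [mul_pow, mul_pow, sq_abs]
          _ ≤ (N * ‖1 - fourier 1 (a : Torus)‖) ^ 2 := by gcongr
          _ = _ := by ring
      rw [l1Weight]
      gcongr
  have h5 : ∫ a in Set.Ioc (-Real.pi) (-Real.pi + 2 * Real.pi), (1 + (b * a) ^ 2)⁻¹ ≤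
      ∫ a : ℝ, (1 + (b * a) ^ 2)⁻¹ :=
    setIntegral_le_integral hint (Filter.Eventually.of_forall fun a => by positivity)
  have h6 : ∫ a : ℝ, (1 + (b * a) ^ 2)⁻¹ = b⁻¹ * Real.pi := by
    have := Measure.integral_comp_mul_left (fun x : ℝ => (1 + x ^ 2)⁻¹) b
    rw [this, integral_univ_inv_one_add_sq, abs_of_pos (by positivity), smul_eq_mul]
  rw [smul_eq_mul]
  calc (2 * Real.pi)⁻¹ * _ ≤ (2 * Real.pi)⁻¹ * (b⁻¹ * Real.pi) := by
        rw [← h6]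
        gcongr
        exact h1.trans h5
    _ = (Real.pi / N) / 4 := by rw [hb]; field_simp; ring
    _ ≤ Real.pi / N := by
        have : 0 < Real.pi / N := by positivity
        linarith

/-- A linearized Cauchy–Schwarz inequality, obtained by completing the square. -/
theorem le_mul_sq_add_inv {d : ℝ} (hd : 0 < d) (y : ℝ) : y ≤ d * y ^ 2 + d⁻¹ := by
  have h2 : (d * y ^ 2 + d⁻¹) - y = d * (y - d⁻¹ / 2) ^ 2 + 3 / 4 * d⁻¹ := by
    field_simp; ring
  have : 0 ≤ d * (y - d⁻¹ / 2) ^ 2 + 3 / 4 * d⁻¹ := by positivity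
  linarith

theorem integrable_real_of_continuous {f : Torus → ℝ} (hf : Continuous f) : Integrable f haar :=
  hf.integrable_of_hasCompactSupport (HasCompactSupport.of_compactSpace f)

/-- The previous inequality is used pointwise with d = δ · `l1Weight N x`, because `l1Weight` times
|u|² is |u|² + N²|v|². The parameter δ stays free so that the two terms can be balanced later. -/
theorem integral_norm_le_of_sq {u v : Torus → ℂ} (hu : Continuous u) (hv : Continuous v)
    (huv : ∀ x, (1 - fourier 1 x) * u x = v x) {N δ : ℝ} (hN : 0 < N) (hδ : 0 < δ) :
    ∫ x, ‖u x‖ ∂haar ≤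
      δ * (∫ x, ‖u x‖ ^ 2 ∂haar + N ^ 2 * ∫ x, ‖v x‖ ^ 2 ∂haar) + Real.pi / (δ * N) := by
  have hc : Continuous fun x => (l1Weight N x)⁻¹ :=
    (continuous_l1Weight N).inv₀ fun x => (zero_lt_one.trans_le (one_le_l1Weight N x)).ne'
  have hpt : ∀ x, ‖u x‖ ≤ δ * (‖u x‖ ^ 2 + N ^ 2 * ‖v x‖ ^ 2) + δ⁻¹ * (l1Weight N x)⁻¹ := by
    intro x
    have hP : 0 < l1Weight N x := zero_lt_one.trans_le (one_le_l1Weight N x)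
    have e : ‖u x‖ ^ 2 + N ^ 2 * ‖v x‖ ^ 2 = l1Weight N x * ‖u x‖ ^ 2 := by
      rw [← huv, norm_mul, l1Weight]; ring
    rw [e, ← mul_inv, ← mul_assoc]
    exact le_mul_sq_add_inv (mul_pos hδ hP) _
  have i1 : Integrable (fun x => ‖u x‖ ^ 2) haar :=
    integrable_real_of_continuous (hu.norm.pow 2)
  have i2 : Integrable (fun x => N ^ 2 * ‖v x‖ ^ 2) haar :=
    integrable_real_of_continuous (continuous_const.mul (hv.norm.pow 2))
  have i4 : Integrable (fun x => δ * (‖u x‖ ^ 2 + N ^ 2 * ‖v x‖ ^ 2)) haar :=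
    (i1.add i2).const_mul δ
  have i3 := (integrable_real_of_continuous hc).const_mul δ⁻¹
  have h1 := integral_mono (integrable_real_of_continuous hu.norm)
    (i4.add i3) hpt
  have h2 : ∫ x, (δ * (‖u x‖ ^ 2 + N ^ 2 * ‖v x‖ ^ 2) + δ⁻¹ * (l1Weight N x)⁻¹) ∂haar =
      δ * (∫ x, ‖u x‖ ^ 2 ∂haar + N ^ 2 * ∫ x, ‖v x‖ ^ 2 ∂haar) +
        δ⁻¹ * ∫ x, (l1Weight N x)⁻¹ ∂haar := by
    rw [integral_add i4 i3, integral_const_mul,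
      integral_const_mul, integral_add i1 i2, integral_const_mul]
  have h3 : δ⁻¹ * ∫ x, (l1Weight N x)⁻¹ ∂haar ≤ δ⁻¹ * (Real.pi / N) :=
    mul_le_mul_of_nonneg_left (integral_inv_l1Weight_le hN) (inv_pos.2 hδ).le
  have h4 : δ⁻¹ * (Real.pi / N) = Real.pi / (δ * N) := by field_simp
  exact (h1.trans_eq h2).trans (add_le_add le_rfl (h3.trans_eq h4))


/-- Bernstein's estimate: `L¹`-norms are controlled by the `ℓ²`-norms of the coefficients and
of their differences. -/
theorem integral_norm_phi_le {mu : ℝ → ℝ} (h : Summable fun k : ℤ => mu (k : ℝ))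
    {N δ : ℝ} (hN : 0 < N) (hδ : 0 < δ) :
    ∫ x, ‖phi mu x‖ ∂haar ≤
      δ * ((∑' k : ℤ, mu (k : ℝ) ^ 2) +
        N ^ 2 * ∑' k : ℤ, (mu (k : ℝ) - mu ((k : ℝ) - 1)) ^ 2) + Real.pi / (δ * N) := by
  have h' := h.sub (summable_comp_sub_one h)
  have e1 := integral_norm_sq_phi h
  have e2 := integral_norm_sq_phi (mu := fun t => mu t - mu (t - 1)) h'
  rw [← e1, ← e2]
  exact integral_norm_le_of_sq (continuous_phi h)
    (continuous_phi (lam := fun t => mu t - mu (t - 1)) h') (one_sub_fourier_mul_phi h) hN hδ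

/-! ### The weight: Potter bounds and differences. -/

/-- The weight `x^{-r} (log (x + 1))^{-κ}`. -/
def maskWeight (r κ x : ℝ) : ℝ := x ^ (-r) * Real.log (x + 1) ^ (-κ)

theorem log_add_one_pos {x : ℝ} (hx : 1 ≤ x) : 0 < Real.log (x + 1) :=
  Real.log_pos (by linarith)

theorem maskWeight_pos (r κ : ℝ) {x : ℝ} (hx : 1 ≤ x) : 0 < maskWeight r κ x :=
  mul_pos (Real.rpow_pos_of_pos (by linarith) _) (Real.rpow_pos_of_pos (log_add_one_pos hx) _)

/-- From (y + 1)(x/y) = x + x/y ≥ x + 1 the two logarithms differ by at most log(x/y), and log(y +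
1) ≥ log 2. -/
theorem log_add_one_div_le {y x : ℝ} (hy : 1 ≤ y) (hyx : y ≤ x) :
    Real.log (x + 1) / Real.log (y + 1) ≤ 1 + Real.log (x / y) / Real.log 2 := by
  have hy0 : 0 < y := by linarith
  have hu : 1 ≤ x / y := (one_le_div hy0).2 hyx
  have hL := log_add_one_pos hy
  have h1 : Real.log (x + 1) ≤ Real.log (y + 1) + Real.log (x / y) := by
    rw [← Real.log_mul (by linarith) (by linarith)]
    refine Real.log_le_log (by linarith) ?_
    have : (y + 1) * (x / y) = x + x / y := by field_simp
    linarith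
  have h2 : Real.log 2 ≤ Real.log (y + 1) := Real.log_le_log two_pos (by linarith)
  have h3 : Real.log (x / y) / Real.log (y + 1) ≤ Real.log (x / y) / Real.log 2 :=
    div_le_div_of_nonneg_left (Real.log_nonneg hu) (Real.log_pos one_lt_two) h2
  calc Real.log (x + 1) / Real.log (y + 1)
      ≤ (Real.log (y + 1) + Real.log (x / y)) / Real.log (y + 1) := by gcongr
    _ = 1 + Real.log (x / y) / Real.log (y + 1) := by rw [add_div, div_self hL.ne']
    _ ≤ _ := by linarith

theorem exists_log_div_rpow_le {a ε : ℝ} (ha : 0 ≤ a) (hε : 0 < ε) :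
    ∃ C : ℝ, 1 ≤ C ∧ ∀ y x : ℝ, 1 ≤ y → y ≤ x →
      (Real.log (x + 1) / Real.log (y + 1)) ^ a ≤ C * (x / y) ^ ε := by
  have hl2 := Real.log_pos one_lt_two
  -- The denominator `a + 1` makes δa ≤ ε and also covers `a = 0`.
  set δ := ε / (a + 1) with hδ
  have hδ0 : 0 < δ := by positivity
  have hD : 1 ≤ 1 + 1 / (δ * Real.log 2) := by
    have : 0 < 1 / (δ * Real.log 2) := by positivity
    linarith
  refine ⟨(1 + 1 / (δ * Real.log 2)) ^ a, Real.one_le_rpow hD ha, fun y x hy hyx => ?_⟩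
  have hy0 : 0 < y := by linarith
  have hu : 1 ≤ x / y := (one_le_div hy0).2 hyx
  have hu0 : 0 ≤ x / y := by linarith
  have h1 : Real.log (x / y) / Real.log 2 ≤ (x / y) ^ δ * (1 / (δ * Real.log 2)) := by
    calc Real.log (x / y) / Real.log 2 ≤ ((x / y) ^ δ / δ) / Real.log 2 := by
          gcongr
          exact Real.log_le_rpow_div hu0 hδ0
      _ = _ := by field_simp
  have h2 : 1 ≤ (x / y) ^ δ := Real.one_le_rpow hu hδ0.le
  have h3 := log_add_one_div_le hy hyx
  have h4 : 0 ≤ Real.log (x + 1) / Real.log (y + 1) :=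
    div_nonneg (log_add_one_pos (hy.trans hyx)).le (log_add_one_pos hy).le
  calc (Real.log (x + 1) / Real.log (y + 1)) ^ a
      ≤ ((1 + 1 / (δ * Real.log 2)) * (x / y) ^ δ) ^ a := by
        refine Real.rpow_le_rpow h4 ?_ ha
        nlinarith
    _ = (1 + 1 / (δ * Real.log 2)) ^ a * (x / y) ^ (δ * a) := by
        rw [Real.mul_rpow (by linarith) (by linarith), ← Real.rpow_mul hu0]
    _ ≤ _ := by
        gcongr ?_ * ?_
        refine Real.rpow_le_rpow_of_exponent_le hu ?_
        · rw [hδ, div_mul_eq_mul_div, div_le_iff₀ (by linarith)]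
          nlinarith

/-- The ratio of the logarithms is at least 1, so its powers with exponents κ and -κ are both at
most the one with exponent |κ|; the sign of κ plays no role. -/
theorem exists_log_rpow_comparison (κ : ℝ) {ε : ℝ} (hε : 0 < ε) :
    ∃ C : ℝ, 1 ≤ C ∧ ∀ y x : ℝ, 1 ≤ y → y ≤ x →
      Real.log (x + 1) ^ (-κ) ≤ C * (x / y) ^ ε * Real.log (y + 1) ^ (-κ) ∧
      Real.log (y + 1) ^ (-κ) ≤ C * (x / y) ^ ε * Real.log (x + 1) ^ (-κ) := by
  obtain ⟨C, hC, h⟩ := exists_log_div_rpow_le (abs_nonneg κ) hε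
  refine ⟨C, hC, fun y x hy hyx => ?_⟩
  have hLy := log_add_one_pos hy
  have hLx := log_add_one_pos (hy.trans hyx)
  have hq : 1 ≤ Real.log (x + 1) / Real.log (y + 1) :=
    (one_le_div hLy).2 (Real.log_le_log (by linarith) (by linarith))
  have key := h y x hy hyx
  constructor
  · rw [← div_le_iff₀ (by positivity), ← Real.div_rpow hLx.le hLy.le]
    exact (Real.rpow_le_rpow_of_exponent_le hq (neg_le_abs κ)).trans key
  · rw [← div_le_iff₀ (by positivity), ← Real.div_rpow hLy.le hLx.le, ← inv_div,
      Real.inv_rpow (by positivity), ← Real.rpow_neg (by positivity), neg_neg]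
    exact (Real.rpow_le_rpow_of_exponent_le hq (le_abs_self κ)).trans key

/-- Potter's bound, to the right. -/
theorem exists_maskWeight_le_of_le (κ : ℝ) {r ρ : ℝ} (hρ : ρ < r) :
    ∃ C : ℝ, 1 ≤ C ∧ ∀ y x : ℝ, 1 ≤ y → y ≤ x →
      maskWeight r κ x ≤ C * (y / x) ^ ρ * maskWeight r κ y := by
  -- The slack `r - ρ` in the exponent pays for the logarithm.
  obtain ⟨C, hC, h⟩ := exists_log_rpow_comparison κ (sub_pos.2 hρ)
  refine ⟨C, hC, fun y x hy hyx => ?_⟩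
  have hy0 : 0 < y := by linarith
  have hx0 : 0 < x := by linarith
  have h1 : (y / x) ^ ρ * y ^ (-r) = x ^ (-r) * (x / y) ^ (r - ρ) := by
    rw [Real.div_rpow hy0.le hx0.le, Real.div_rpow hx0.le hy0.le, Real.rpow_sub hx0,
      Real.rpow_sub hy0, Real.rpow_neg hx0.le, Real.rpow_neg hy0.le]
    have := Real.rpow_pos_of_pos hx0 r
    have := Real.rpow_pos_of_pos hx0 ρ
    have := Real.rpow_pos_of_pos hy0 r
    have := Real.rpow_pos_of_pos hy0 ρ
    field_simp
  calc maskWeight r κ x ≤ x ^ (-r) * (C * (x / y) ^ (r - ρ) * Real.log (y + 1) ^ (-κ)) := by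
        rw [maskWeight]
        gcongr
        exact (h y x hy hyx).1
    _ = C * (x ^ (-r) * (x / y) ^ (r - ρ)) * Real.log (y + 1) ^ (-κ) := by ring
    _ = _ := by rw [← h1, maskWeight]; ring

/-- Potter's bound, to the left. -/
theorem exists_maskWeight_le_of_ge (r κ : ℝ) :
    ∃ C : ℝ, 1 ≤ C ∧ ∀ y x : ℝ, 1 ≤ y → y ≤ x →
      maskWeight r κ y ≤ C * (x / y) ^ (r + 1) * maskWeight r κ x := by
  -- The extra power in `r + 1` pays for the logarithm.
  obtain ⟨C, hC, h⟩ := exists_log_rpow_comparison κ one_pos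
  refine ⟨C, hC, fun y x hy hyx => ?_⟩
  have hy0 : 0 < y := by linarith
  have hx0 : 0 < x := by linarith
  have h1 : (x / y) ^ (r + 1) * x ^ (-r) = y ^ (-r) * (x / y) ^ (1 : ℝ) := by
    rw [Real.rpow_add (by positivity), Real.div_rpow hx0.le hy0.le, Real.rpow_neg hx0.le,
      Real.rpow_neg hy0.le]
    have := Real.rpow_pos_of_pos hx0 r
    have := Real.rpow_pos_of_pos hy0 r
    field_simp
  calc maskWeight r κ y ≤ y ^ (-r) * (C * (x / y) ^ (1 : ℝ) * Real.log (x + 1) ^ (-κ)) := by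
        rw [maskWeight]
        gcongr
        exact (h y x hy hyx).2
    _ = C * (y ^ (-r) * (x / y) ^ (1 : ℝ)) * Real.log (x + 1) ^ (-κ) := by ring
    _ = _ := by rw [← h1, maskWeight]; ring

theorem hasDerivAt_maskWeight (r κ : ℝ) {t : ℝ} (ht : 1 ≤ t) :
    HasDerivAt (maskWeight r κ)
      (-(r / t + κ / ((t + 1) * Real.log (t + 1))) * maskWeight r κ t) t := by
  have ht0 : 0 < t := by linarith
  have hL := log_add_one_pos ht
  have h1 : HasDerivAt (fun t : ℝ => t ^ (-r)) (-r * t ^ (-r - 1)) t :=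
    Real.hasDerivAt_rpow_const (Or.inl ht0.ne')
  have h2 : HasDerivAt (fun t : ℝ => Real.log (t + 1)) (1 / (t + 1)) t :=
    ((hasDerivAt_id t).add_const 1).log (by simp only [id]; linarith)
  have h3 := h2.rpow_const (p := -κ) (Or.inl hL.ne')
  refine (h1.mul h3).congr_deriv ?_
  rw [maskWeight, Real.rpow_sub_one ht0.ne', Real.rpow_sub_one hL.ne']
  have : t + 1 ≠ 0 := by linarith
  field_simp
  ring

theorem abs_deriv_maskWeight_le (r κ : ℝ) {t : ℝ} (ht : 1 ≤ t) :
    |deriv (maskWeight r κ) t| ≤ (|r| + |κ| / Real.log 2) * (maskWeight r κ t / t) := by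
  have ht0 : 0 < t := by linarith
  have hl2 := Real.log_pos one_lt_two
  have hw := maskWeight_pos r κ ht
  rw [(hasDerivAt_maskWeight r κ ht).deriv, abs_mul, abs_neg, abs_of_pos hw]
  have h1 : |r / t + κ / ((t + 1) * Real.log (t + 1))| ≤ (|r| + |κ| / Real.log 2) / t := by
    refine (abs_add_le _ _).trans ?_
    rw [abs_div, abs_div, abs_of_pos ht0, add_div, div_div,
      abs_of_pos (mul_pos (by linarith) (log_add_one_pos ht)), mul_comm (Real.log 2)]
    gcongr <;> linarith
  calc _ ≤ (|r| + |κ| / Real.log 2) / t * maskWeight r κ t := by gcongr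
    _ = _ := by ring

/-- Mean value theorem on [x - 1, x]: there t ≥ x/2, so the weight at t is comparable to that at x,
and its logarithmic derivative is O(1/t). -/
theorem exists_maskWeight_sub_le {r : ℝ} (κ : ℝ) (hr : 0 ≤ r) :
    ∃ C : ℝ, 1 ≤ C ∧ ∀ x : ℝ, 2 ≤ x → maskWeight r κ (x - 1) ≤ C * maskWeight r κ x ∧
      |maskWeight r κ x - maskWeight r κ (x - 1)| ≤ C * (maskWeight r κ x / x) := by
  obtain ⟨C, hC, h⟩ := exists_maskWeight_le_of_ge r κ
  have hl2 := Real.log_pos one_lt_two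
  set D := |r| + |κ| / Real.log 2 with hD
  have hD0 : 0 ≤ D := by positivity
  set E := C * 2 ^ (r + 1) with hE
  have hE1 : 1 ≤ E := one_le_mul_of_one_le_of_one_le hC
    (Real.one_le_rpow one_le_two (by linarith))
  have hloc : ∀ x t : ℝ, 2 ≤ x → x - 1 ≤ t → t ≤ x →
      maskWeight r κ t ≤ E * maskWeight r κ x := by
    intro x t hx h1 h2
    refine (h t x (by linarith) h2).trans ?_
    have : 0 < maskWeight r κ x := maskWeight_pos r κ (by linarith)
    rw [hE]
    have h3 : x / t ≤ 2 := by rw [div_le_iff₀] <;> linarith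
    have h4 : 0 ≤ x / t := div_nonneg (by linarith) (by linarith)
    gcongr
  refine ⟨E + D * (E * 2), by nlinarith, fun x hx => ?_⟩
  have hw : 0 < maskWeight r κ x := maskWeight_pos r κ (by linarith)
  have hx0 : 0 < x := by linarith
  refine ⟨(hloc x (x - 1) hx le_rfl (by linarith)).trans ?_, ?_⟩
  · gcongr
    have : 0 ≤ D * (E * 2) := by positivity
    linarith
  · have := (convex_Icc (x - 1) x).norm_image_sub_le_of_norm_deriv_le (𝕜 := ℝ)
      (f := maskWeight r κ) (C := D * (E * 2) * (maskWeight r κ x / x))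
      (fun t ht => (hasDerivAt_maskWeight r κ (by linarith [ht.1])).differentiableAt) (fun t ht => ?_)
      (Set.left_mem_Icc.2 (by linarith)) (Set.right_mem_Icc.2 (by linarith))
    · rw [Real.norm_eq_abs, sub_sub_cancel, norm_one, mul_one] at this
      refine this.trans ?_
      gcongr
      linarith
    · have ht1 : 1 ≤ t := by linarith [ht.1]
      rw [Real.norm_eq_abs]
      refine (abs_deriv_maskWeight_le r κ ht1).trans ?_
      have h1 := hloc x t hx ht.1 ht.2
      have h2 : 1 / t ≤ 2 / x := by
        rw [div_le_div_iff₀ (by linarith) hx0]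
        linarith [ht.1]
      calc D * (maskWeight r κ t / t) = D * (maskWeight r κ t * (1 / t)) := by ring
        _ ≤ D * (E * maskWeight r κ x * (2 / x)) := by gcongr
        _ = _ := by ring

/-! ### Size, differences and summability of mask coefficients. -/

/-- The coefficients of a mask at the natural numbers, and their differences. -/
theorem IsMask.exists_nat_bound {r κ : ℝ} {f : ℝ → ℝ} (hr : 0 ≤ r) (hf : IsMask r κ f) :
    ∃ C : ℝ, 1 ≤ C ∧ ∀ n : ℕ, 1 ≤ n → |f n| ≤ C * maskWeight r κ n ∧
      |f n - f (n - 1)| ≤ C * (maskWeight r κ n / n) := by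
  obtain ⟨-, hsm, F, a, hF, ha⟩ := hf
  obtain ⟨C, hC, hw⟩ := exists_maskWeight_sub_le κ hr
  have hF' : ∀ t : ℝ, 1 ≤ t → f t = maskWeight r κ t * F (Real.log t) := fun t ht => by
    rw [hF t ht, abs_of_pos (by linarith), maskWeight]
  -- A bound on `deriv F` says nothing where `F` fails to be differentiable, since `deriv` is then 0
  -- by default. Differentiability comes from F(u) = f(e^u)/w(e^u), valid for all u ≥ 0 and hence
  -- near each u ≥ 1.
  have hFd : ∀ u : ℝ, 1 ≤ u → DifferentiableAt ℝ F u := by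
    intro u hu
    have he : 1 ≤ Real.exp u := Real.one_le_exp (by linarith)
    have h1 : DifferentiableAt ℝ (fun u => f (Real.exp u) / maskWeight r κ (Real.exp u)) u := by
      refine DifferentiableAt.fun_div ?_ ?_ (maskWeight_pos r κ he).ne'
      · exact ((hsm.differentiable (by norm_num)) _).comp u Real.differentiableAt_exp
      · exact (hasDerivAt_maskWeight r κ he).differentiableAt.comp u Real.differentiableAt_exp
    refine h1.congr_of_eventuallyEq ?_
    filter_upwards [lt_mem_nhds (show 0 < u by linarith)] with v hv
    have he' : 1 ≤ Real.exp v := Real.one_le_exp hv.le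
    rw [hF' _ he', Real.log_exp, mul_div_cancel_left₀ _ (maskWeight_pos r κ he').ne']
  have hFb : ∀ t : ℝ, 1 ≤ t → |F t| ≤ a := fun t ht => by simpa using ha t ht 0 (by norm_num)
  have ha0 : 0 ≤ a := (abs_nonneg _).trans (hFb 1 le_rfl)
  have hFl : ∀ s t : ℝ, 1 ≤ s → s ≤ t → |F t - F s| ≤ a * (t - s) := by
    intro s t hs hst
    have := (convex_Ici (1 : ℝ)).norm_image_sub_le_of_norm_deriv_le (𝕜 := ℝ) (f := F) (C := a)
      (fun u hu => hFd u hu) (fun u hu => by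
        simpa [iteratedDeriv_one] using ha u hu 1 (by norm_num))
      (Set.mem_Ici.2 hs) (Set.mem_Ici.2 (hs.trans hst))
    rwa [Real.norm_eq_abs, Real.norm_eq_abs, abs_of_nonneg (sub_nonneg.2 hst)] at this
  have hexp : Real.exp 1 ≤ 3 := by linarith [Real.exp_one_lt_d9]
  -- For n ≥ 4 one has log(n - 1) ≥ log 3 ≥ 1, so `F` is evaluated only where its bounds apply. The
  -- differences then follow from the discrete product rule.
  have hlarge : ∀ n : ℕ, 4 ≤ n → |f n| ≤ a * maskWeight r κ n ∧
      |f n - f (n - 1)| ≤ (C * a + C * a * 2) * (maskWeight r κ n / n) := by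
    intro n hn
    have hn4 : (4 : ℝ) ≤ n := by exact_mod_cast hn
    have hwn : 0 < maskWeight r κ n := maskWeight_pos r κ (by linarith)
    have hl1 : 1 ≤ Real.log ((n : ℝ) - 1) := by
      rw [Real.le_log_iff_exp_le (by linarith)]; linarith
    have hl2 : Real.log ((n : ℝ) - 1) ≤ Real.log n := Real.log_le_log (by linarith) (by linarith)
    have hl3 : Real.log n - Real.log ((n : ℝ) - 1) ≤ 2 / n := by
      rw [← Real.log_div (by linarith) (by linarith)]
      refine (Real.log_le_sub_one_of_pos (div_pos (by linarith) (by linarith))).trans ?_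
      rw [div_sub_one (by linarith), div_le_div_iff₀ (by linarith) (by linarith)]
      linarith
    obtain ⟨h1, h2⟩ := hw n (by linarith)
    have h3 := hFb (Real.log n) (hl1.trans hl2)
    have h4 := hFl _ _ hl1 hl2
    have hwn' : 0 < maskWeight r κ ((n : ℝ) - 1) := maskWeight_pos r κ (by linarith)
    rw [hF' n (by linarith), hF' ((n : ℝ) - 1) (by linarith)]
    refine ⟨?_, ?_⟩
    · rw [abs_mul, abs_of_pos hwn, mul_comm]
      gcongr
    · have e : maskWeight r κ n * F (Real.log n) -
          maskWeight r κ ((n : ℝ) - 1) * F (Real.log ((n : ℝ) - 1)) =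
          (maskWeight r κ n - maskWeight r κ ((n : ℝ) - 1)) * F (Real.log n) +
          maskWeight r κ ((n : ℝ) - 1) * (F (Real.log n) - F (Real.log ((n : ℝ) - 1))) := by ring
      rw [e]
      refine (abs_add_le _ _).trans ?_
      rw [abs_mul, abs_mul, abs_of_pos hwn']
      calc _ ≤ C * (maskWeight r κ n / n) * a + C * maskWeight r κ n * (a * (2 / n)) := by
            gcongr
            exact h4.trans (by gcongr)
        _ = _ := by ring
  have hw1 : ∀ n : ℕ, 1 ≤ n → 0 < maskWeight r κ n := fun n hn =>
    maskWeight_pos r κ (by exact_mod_cast hn)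
  -- The remaining n = 1, 2, 3 are absorbed by adding their own ratios to the constant.
  set S := ∑ n ∈ Finset.Icc (1 : ℕ) 3, (|f (n : ℝ)| / maskWeight r κ (n : ℝ) +
    |f (n : ℝ) - f ((n : ℝ) - 1)| / (maskWeight r κ (n : ℝ) / (n : ℝ))) with hS
  have hterm : ∀ n ∈ Finset.Icc (1 : ℕ) 3, 0 ≤ |f (n : ℝ)| / maskWeight r κ (n : ℝ) +
      |f (n : ℝ) - f ((n : ℝ) - 1)| / (maskWeight r κ (n : ℝ) / (n : ℝ)) := by
    intro n hn
    have := hw1 n (Finset.mem_Icc.1 hn).1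
    positivity
  have hS0 : 0 ≤ S := Finset.sum_nonneg hterm
  refine ⟨1 + a + (C * a + C * a * 2) + S, ?_, fun n hn => ?_⟩
  · have : 0 ≤ C * a + C * a * 2 := by positivity
    linarith
  have hn0 : (0 : ℝ) < n := by exact_mod_cast hn
  have hwn := hw1 n hn
  have hCa : 0 ≤ C * a + C * a * 2 := by positivity
  rcases le_or_gt 4 n with h4 | h4
  · obtain ⟨h1, h2⟩ := hlarge n h4
    refine ⟨h1.trans ?_, h2.trans ?_⟩ <;> gcongr ?_ * _ <;> linarith
  · have h5 := Finset.single_le_sum hterm (Finset.mem_Icc.2 ⟨hn, by omega⟩ : n ∈ Finset.Icc (1 : ℕ) 3)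
    rw [← hS] at h5
    have h6 : 0 ≤ |f n| / maskWeight r κ n := by positivity
    have h7 : 0 ≤ |f n - f (n - 1)| / (maskWeight r κ n / n) := by positivity
    refine ⟨?_, ?_⟩
    · rw [← div_le_iff₀ hwn]; linarith
    · rw [← div_le_iff₀ (by positivity)]; linarith

/-- The coefficients of a mask at the integers, and their differences. -/
theorem IsMask.exists_int_bound {r κ : ℝ} {f : ℝ → ℝ} (hr : 0 < r) (hf : IsMask r κ f) :
    ∃ C : ℝ, 1 ≤ C ∧ ∀ k : ℤ, |f k| ≤ C * maskWeight r κ (max |(k : ℝ)| 1) ∧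
      |f k - f (k - 1)| ≤ C * (maskWeight r κ (max |(k : ℝ)| 1) / max |(k : ℝ)| 1) := by
  obtain ⟨C, hC, hb⟩ := hf.exists_nat_bound hr.le
  -- With ρ = 0 Potter's bound says that the weight is almost decreasing.
  obtain ⟨C₂, hC₂, hp⟩ := exists_maskWeight_le_of_le κ (ρ := 0) hr
  have heven := hf.1
  have hw1 := maskWeight_pos r κ le_rfl
  have hnat : ∀ n : ℕ, |f n| ≤ (C * C₂ + |f 0| / maskWeight r κ 1) *
      maskWeight r κ (max (n : ℝ) 1) := by
    intro n
    have hwn : 0 < maskWeight r κ (max (n : ℝ) 1) := maskWeight_pos r κ (le_max_right _ _)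
    rcases Nat.eq_zero_or_pos n with rfl | hn
    · have h0 : 0 ≤ C * C₂ := by positivity
      have e : max ((0 : ℕ) : ℝ) 1 = 1 := by simp
      rw [e, ← div_le_iff₀ hw1, Nat.cast_zero]
      linarith
    · have hn1 : (1 : ℝ) ≤ n := by exact_mod_cast hn
      rw [max_eq_left hn1] at hwn ⊢
      refine (hb n hn).1.trans ?_
      gcongr
      have : 0 ≤ |f 0| / maskWeight r κ 1 := by positivity
      nlinarith
  refine ⟨C * C₂ + |f 0| / maskWeight r κ 1, ?_, fun k => ⟨?_, ?_⟩⟩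
  · have : 0 ≤ |f 0| / maskWeight r κ 1 := by positivity
    nlinarith
  · have h := hnat k.natAbs
    have e : ((k.natAbs : ℕ) : ℝ) = |(k : ℝ)| := by simp [Nat.cast_natAbs]
    rw [e] at h
    rcases abs_choice (k : ℝ) with hk | hk <;> rw [hk] at h ⊢
    · exact h
    · rwa [heven] at h
  · have hν : 0 < max |(k : ℝ)| 1 := by positivity
    have hwk : 0 < maskWeight r κ (max |(k : ℝ)| 1) := maskWeight_pos r κ (le_max_right _ _)
    have h0 : 0 ≤ |f 0| / maskWeight r κ 1 := by positivity
    rcases le_or_gt k 0 with hk | hk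
    -- For k = -n evenness turns the backward difference at k into the one at n + 1, up to sign;
    -- almost monotonicity carries the bound from n + 1 back to max(n, 1).
    · obtain ⟨n, rfl⟩ := Int.exists_eq_neg_ofNat hk
      have h1 := (hb (n + 1) (by omega)).2
      have e1 : f ((-(n : ℤ) : ℤ) : ℝ) = f n := by push_cast; exact heven _
      have e2 : f (((-(n : ℤ) : ℤ) : ℝ) - 1) = f ((n : ℝ) + 1) := by
        rw [← heven]; congr 1; push_cast; ring
      have e3 : |((-(n : ℤ) : ℤ) : ℝ)| = n := by simp
      rw [e1, e2, abs_sub_comm]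
      rw [e3] at hν hwk ⊢
      push_cast at h1
      rw [add_sub_cancel_right] at h1
      have hle : max (n : ℝ) 1 ≤ (n : ℝ) + 1 := max_le (by linarith) (by
        have : (0 : ℝ) ≤ n := n.cast_nonneg
        linarith)
      have h2 := hp (max (n : ℝ) 1) ((n : ℝ) + 1) (le_max_right _ _) hle
      rw [Real.rpow_zero, mul_one] at h2
      calc _ ≤ C * (maskWeight r κ ((n : ℝ) + 1) / ((n : ℝ) + 1)) := h1
        _ ≤ C * (C₂ * maskWeight r κ (max (n : ℝ) 1) / max (n : ℝ) 1) := by gcongr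
        _ = C * C₂ * (maskWeight r κ (max (n : ℝ) 1) / max (n : ℝ) 1) := by ring
        _ ≤ _ := by gcongr; linarith
    · obtain ⟨n, rfl⟩ := Int.eq_ofNat_of_zero_le hk.le
      have hn : 1 ≤ n := by exact_mod_cast hk
      have hn1 : (1 : ℝ) ≤ n := by exact_mod_cast hn
      have h1 := (hb n hn).2
      have e3 : max |(((n : ℕ) : ℤ) : ℝ)| 1 = n := by simp [hn1]
      rw [e3] at hν hwk ⊢
      rw [Int.cast_natCast]
      refine h1.trans ?_
      gcongr
      nlinarith

theorem IsMask.summable {r κ : ℝ} {f : ℝ → ℝ} (hr : 1 < r) (hf : IsMask r κ f) :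
    Summable fun k : ℤ => f (k : ℝ) := by
  obtain ⟨C, hC, hb⟩ := hf.exists_int_bound (by linarith)
  -- An exponent strictly between 1 and r: still summable, with room left for the logarithm.
  obtain ⟨C₂, hC₂, hp⟩ := exists_maskWeight_le_of_le κ (r := r) (ρ := (r + 1) / 2) (by linarith)
  have hw1 := maskWeight_pos r κ le_rfl
  have hs : Summable fun k : ℤ => C * (C₂ * maskWeight r κ 1) * |(k : ℝ)| ^ (-((r + 1) / 2)) :=
    (Real.summable_abs_int_rpow (by linarith)).mul_left _
  -- The index 0 must be left out: there the majorant is 0 by the convention for `rpow`.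
  refine Summable.of_norm_bounded_eventually hs ?_
  rw [Filter.eventually_cofinite]
  refine (Set.finite_singleton (0 : ℤ)).subset fun k hk => ?_
  by_contra h0
  refine hk ?_
  have hk1 : 1 ≤ |(k : ℝ)| := by
    have : 1 ≤ |k| := Int.one_le_abs h0
    exact_mod_cast this
  rw [Real.norm_eq_abs]
  refine (hb k).1.trans ?_
  rw [max_eq_left hk1]
  have h1 := hp 1 |(k : ℝ)| le_rfl hk1
  rw [one_div, Real.inv_rpow (abs_nonneg _), ← Real.rpow_neg (abs_nonneg _)] at h1
  calc _ ≤ C * (C₂ * |(k : ℝ)| ^ (-((r + 1) / 2)) * maskWeight r κ 1) := by gcongr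
    _ = _ := by ring

/-! ### The high frequency kernel. -/

/-- Telescoping, since (m + n)(m + n + 1) ≤ 4(m² + n²) for m ≥ 1. -/
theorem sum_range_inv_sq_add_sq_le {m : ℝ} (hm : 1 ≤ m) (N : ℕ) :
    ∑ n ∈ Finset.range N, 1 / (m ^ 2 + (n : ℝ) ^ 2) ≤ 4 / m := by
  have h : ∀ n : ℕ, 1 / (m ^ 2 + (n : ℝ) ^ 2) ≤
      4 * (1 / (m + n) - 1 / (m + (n + 1 : ℕ))) := by
    intro n
    have hn : (0 : ℝ) ≤ n := n.cast_nonneg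
    have e : 4 * (1 / (m + n) - 1 / (m + (n + 1 : ℕ))) = 4 / ((m + n) * (m + n + 1)) := by
      push_cast
      field_simp
      ring
    rw [e, div_le_div_iff₀ (by positivity) (by positivity)]
    nlinarith [sq_nonneg (m - n)]
  calc _ ≤ ∑ n ∈ Finset.range N, 4 * (1 / (m + n) - 1 / (m + (n + 1 : ℕ))) :=
        Finset.sum_le_sum fun n _ => h n
    _ = 4 * (1 / m - 1 / (m + N)) := by
        rw [← Finset.mul_sum, Finset.sum_range_sub' (fun n : ℕ => 1 / (m + (n : ℝ)))]
        simp
    _ ≤ 4 / m := by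
        have : 0 ≤ 1 / (m + (N : ℝ)) := by positivity
        rw [mul_sub, mul_one_div]
        linarith

theorem summable_and_tsum_inv_sq_add_sq_le {m : ℝ} (hm : 1 ≤ m) :
    (Summable fun k : ℤ => 1 / (m ^ 2 + (k : ℝ) ^ 2)) ∧
      ∑' k : ℤ, 1 / (m ^ 2 + (k : ℝ) ^ 2) ≤ 8 / m := by
  have hs : Summable fun n : ℕ => 1 / (m ^ 2 + (n : ℝ) ^ 2) :=
    summable_of_sum_range_le (fun n => by positivity) (sum_range_inv_sq_add_sq_le hm)
  have hs' : Summable fun n : ℕ => 1 / (m ^ 2 + ((n + 1 : ℕ) : ℝ) ^ 2) :=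
    (summable_nat_add_iff (f := fun n : ℕ => 1 / (m ^ 2 + (n : ℝ) ^ 2)) 1).2 hs
  have h1 : ∑' n : ℕ, 1 / (m ^ 2 + (n : ℝ) ^ 2) ≤ 4 / m :=
    Real.tsum_le_of_sum_range_le (fun n => by positivity) (sum_range_inv_sq_add_sq_le hm)
  have h2 : ∑' n : ℕ, 1 / (m ^ 2 + ((n + 1 : ℕ) : ℝ) ^ 2) ≤ 4 / m := by
    refine (hs'.tsum_le_tsum (fun n => ?_) hs).trans h1
    push_cast
    gcongr
    linarith
  have h3 : HasSum (fun k : ℤ => 1 / (m ^ 2 + (k : ℝ) ^ 2)) _ :=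
    HasSum.of_nat_of_neg_add_one (by simp only [Int.cast_natCast]; exact hs.hasSum)
      (by
        have e : (fun n : ℕ => 1 / (m ^ 2 + ((-((n : ℤ) + 1) : ℤ) : ℝ) ^ 2)) =
            fun n : ℕ => 1 / (m ^ 2 + ((n + 1 : ℕ) : ℝ) ^ 2) := by
          funext n
          congr 2
          push_cast
          ring
        rw [e]
        exact hs'.hasSum)
  refine ⟨h3.summable, ?_⟩
  rw [h3.tsum_eq]
  have : (8 : ℝ) / m = 4 / m + 4 / m := by ring
  rw [this]
  exact add_le_add h1 h2

theorem IsCutoff.exists_bound {vth : ℝ → ℝ} (h : IsCutoff vth) :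
    ∃ B : ℝ, 1 ≤ B ∧ (∀ x, |vth x| ≤ B) ∧ ∀ x y, |vth x - vth y| ≤ B * |x - y| := by
  obtain ⟨hs, -, h0⟩ := h
  have hc : HasCompactSupport vth :=
    HasCompactSupport.intro (isCompact_Icc (a := -1) (b := 1)) fun x hx =>
      h0 x fun hx' => hx (Set.Ioo_subset_Icc_self hx')
  obtain ⟨L, hL⟩ := ContDiff.lipschitzWith_of_hasCompactSupport hc hs (by norm_num)
  obtain ⟨M, hM⟩ := hc.exists_bound_of_continuous hs.continuous
  refine ⟨1 + |M| + L, by linarith [abs_nonneg M, L.coe_nonneg], fun x => ?_, fun x y => ?_⟩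
  · have := hM x
    rw [Real.norm_eq_abs] at this
    linarith [le_abs_self M, L.coe_nonneg]
  · have := hL.dist_le_mul x y
    rw [Real.dist_eq, Real.dist_eq] at this
    refine this.trans ?_
    gcongr
    linarith [abs_nonneg M]

/-- Away from the origin the weight is bounded by its value at `m` times `m / x`. -/
theorem exists_maskWeight_le_mul_div (κ : ℝ) {r : ℝ} (hr : 1 < r) :
    ∃ C : ℝ, 1 ≤ C ∧ ∀ m x : ℝ, 1 ≤ m → 1 ≤ x → m ≤ 4 * x →
      maskWeight r κ x ≤ C * maskWeight r κ m * (m / x) := by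
  -- Here ρ = 1, allowed because r > 1; one full power of m/x is what makes the later bound square
  -- summable.
  obtain ⟨C₁, hC₁, h₁⟩ := exists_maskWeight_le_of_le κ hr
  obtain ⟨C₂, hC₂, h₂⟩ := exists_maskWeight_le_of_ge r κ
  have h4 : 1 ≤ (4 : ℝ) ^ (r + 1) := Real.one_le_rpow (by norm_num) (by linarith)
  refine ⟨C₁ + C₂ * 4 ^ (r + 1), by nlinarith, fun m x hm hx hmx => ?_⟩
  have hw := maskWeight_pos r κ hm
  have hx0 : 0 < x := by linarith
  have hm0 : 0 < m := by linarith
  rcases le_total m x with h | h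
  · refine (h₁ m x hm h).trans ?_
    rw [Real.rpow_one]
    calc C₁ * (m / x) * maskWeight r κ m = C₁ * maskWeight r κ m * (m / x) := by ring
      _ ≤ _ := by
        gcongr
        have : 0 ≤ C₂ * (4 : ℝ) ^ (r + 1) := by positivity
        linarith
  · refine (h₂ x m hx h).trans ?_
    have h5 : m / x ≤ 4 := (div_le_iff₀ hx0).2 hmx
    have h6 : 1 ≤ m / x := (one_le_div hx0).2 h
    calc C₂ * (m / x) ^ (r + 1) * maskWeight r κ m
        ≤ C₂ * 4 ^ (r + 1) * maskWeight r κ m := by gcongr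
      _ ≤ (C₁ + C₂ * 4 ^ (r + 1)) * maskWeight r κ m * 1 := by
        rw [mul_one]; gcongr; linarith
      _ ≤ _ := by gcongr

/-- The coefficients `(1 - vth(k/m)) f(k)` of the high frequency part. -/
def highPart (vth f : ℝ → ℝ) (m : ℕ) (t : ℝ) : ℝ := (1 - vth (t / m)) * f t

/-- Differencing either the mask or the cut-off gains a factor O(1/|k|), and m/|k| is bounded where
the result is not zero; hence the factor m in front of the differences costs nothing. The last
clause records the vanishing at low frequencies, where the stated size bounds alone would give too
large a sum of squares. -/
theorem exists_highPart_bound {r κ : ℝ} {f vth : ℝ → ℝ} (hr : 1 < r) (hf : IsMask r κ f)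
    (hv : IsCutoff vth) :
    ∃ C : ℝ, 1 ≤ C ∧ ∀ m : ℕ, 1 ≤ m → ∀ k : ℤ,
      |highPart vth f m k| ≤ C * (maskWeight r κ m * m / max |(k : ℝ)| 1) ∧
      m * |highPart vth f m k - highPart vth f m (k - 1)| ≤
        C * (maskWeight r κ m * m / max |(k : ℝ)| 1) ∧
      ((m : ℝ) ≤ 4 * max |(k : ℝ)| 1 ∨
        highPart vth f m k = 0 ∧ highPart vth f m k - highPart vth f m (k - 1) = 0) := by
  obtain ⟨C, hC, hb⟩ := hf.exists_int_bound (by linarith)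
  obtain ⟨B, hB, hvb, hvl⟩ := hv.exists_bound
  obtain ⟨D, hD, hD'⟩ := exists_maskWeight_le_mul_div κ hr
  obtain ⟨-, hv1, hv0⟩ := hv
  refine ⟨8 * (2 * B * C + 4 * B * C) * D, by
    have : 1 ≤ B * C := one_le_mul_of_one_le_of_one_le hB hC
    nlinarith, fun m hm k => ?_⟩
  have hm1 : (1 : ℝ) ≤ m := by exact_mod_cast hm
  have hm0 : (0 : ℝ) < m := by linarith
  have hwm := maskWeight_pos r κ hm1
  set ν := max |(k : ℝ)| 1 with hν
  have hν1 : 1 ≤ ν := le_max_right _ _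
  have hkν : |(k : ℝ)| ≤ ν := le_max_left _ _
  have hsub : |(k : ℝ) - 1| ≤ |(k : ℝ)| + 1 := by
    simpa using abs_sub (k : ℝ) 1
  have hlow : ∀ t : ℝ, 2 * |t| ≤ m → vth (t / m) = 1 := by
    intro t ht
    refine hv1 _ (Set.mem_Icc.2 (abs_le.1 ?_))
    rw [abs_div, abs_of_pos hm0, div_le_iff₀ hm0]
    linarith
  have hhigh : ∀ t : ℝ, m ≤ |t| → vth (t / m) = 0 := by
    intro t ht
    refine hv0 _ fun h => ?_
    have := abs_lt.2 h
    rw [abs_div, abs_of_pos hm0, div_lt_one hm0] at this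
    linarith
  have hzero : ∀ t : ℝ, 2 * |t| ≤ m → highPart vth f m t = 0 := by
    intro t ht
    rw [highPart, hlow t ht, sub_self, zero_mul]
  -- If 4ν < m, then |k - 1| ≤ 2ν < m/2, so k and k - 1 both lie on the plateau of the cut-off.
  rcases le_or_gt (m : ℝ) (4 * ν) with hmν | hmν
  swap
  · have h1 : 2 * |(k : ℝ)| ≤ m := by linarith
    have h2 : 2 * |(k : ℝ) - 1| ≤ m := by linarith
    have h3 : 0 ≤ maskWeight r κ m * m / ν := by positivity
    rw [hzero _ h1, hzero _ h2]
    simp only [sub_self, abs_zero, mul_zero, and_self, or_true, and_true]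
    positivity
  obtain ⟨hb1, hb2⟩ := hb k
  have hwν := maskWeight_pos r κ hν1
  have hDν := hD' m ν hm1 hν1 hmν
  have hv2 : ∀ t, |1 - vth t| ≤ 2 * B := fun t => by
    refine (abs_sub _ _).trans ?_
    rw [abs_one]
    linarith [hvb t]
  have hν0 : 0 < ν := by linarith
  refine ⟨?_, ?_, Or.inl hmν⟩
  · rw [highPart, abs_mul]
    calc |1 - vth (k / m)| * |f k| ≤ 2 * B * (C * (D * maskWeight r κ m * (m / ν))) := by
          gcongr
          · exact hv2 _
          · exact hb1.trans (by gcongr)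
      _ = 2 * B * C * D * (maskWeight r κ m * m / ν) := by ring
      _ ≤ _ := by
        gcongr ?_ * _
        have : 0 ≤ B * C * D := by positivity
        nlinarith
  · have hlam' : |f (k - 1)| ≤ 2 * C * maskWeight r κ ν := by
      have h1 : |f (k - 1)| ≤ |f k| + |f k - f (k - 1)| := by
        have := abs_sub (f k) (f k - f (k - 1))
        rwa [sub_sub_cancel] at this
      have h2 : maskWeight r κ ν / ν ≤ maskWeight r κ ν := div_le_self hwν.le hν1
      nlinarith
    -- For |k| ≤ 2m the Lipschitz bound B/m is at most 2B/ν; for |k| > 2m both values vanish.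
    have hvd : |vth (k / m) - vth ((k - 1) / m)| ≤ 2 * B / ν := by
      rcases le_or_gt |(k : ℝ)| (2 * m) with hk | hk
      · refine (hvl _ _).trans ?_
        rw [← sub_div, sub_sub_cancel, abs_of_pos (by positivity), mul_one_div,
          div_le_div_iff₀ hm0 hν0]
        have : ν ≤ 2 * m := max_le hk (by linarith)
        nlinarith
      · have h1 : |(k : ℝ)| ≤ |(k : ℝ) - 1| + 1 := by
          simpa using abs_add_le ((k : ℝ) - 1) 1
        rw [hhigh _ (by linarith), hhigh _ (by linarith), sub_self, abs_zero]
        positivity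
    have e : highPart vth f m k - highPart vth f m (k - 1) =
        (1 - vth (k / m)) * (f k - f (k - 1)) -
          (vth (k / m) - vth ((k - 1) / m)) * f (k - 1) := by
      rw [highPart, highPart]; ring
    have h1 : |highPart vth f m k - highPart vth f m (k - 1)| ≤
        (2 * B * C + 4 * B * C) * (maskWeight r κ ν / ν) := by
      rw [e]
      refine (abs_sub _ _).trans ?_
      rw [abs_mul, abs_mul]
      calc _ ≤ 2 * B * (C * (maskWeight r κ ν / ν)) + 2 * B / ν * (2 * C * maskWeight r κ ν) := by
            gcongr
            exact hv2 _
        _ = _ := by ring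
    calc _ ≤ m * ((2 * B * C + 4 * B * C) * (D * maskWeight r κ m * (m / ν) / ν)) := by
          gcongr
          exact h1.trans (by gcongr)
      _ = (m / ν) * (2 * B * C + 4 * B * C) * D * (maskWeight r κ m * m / ν) := by ring
      _ ≤ _ := by
        have : (m : ℝ) / ν ≤ 8 := by
          rw [div_le_iff₀ hν0]; linarith
        gcongr

/-- On the range m ≤ 4 max(|k|, 1), the bound w(m) m/|k| squares to O(w(m)² m²/(m² + k²)), and the
sum of 1/(m² + k²) is O(1/m). -/
theorem exists_sq_sum_highPart_le {r κ : ℝ} {f vth : ℝ → ℝ} (hr : 1 < r) (hf : IsMask r κ f)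
    (hv : IsCutoff vth) :
    ∃ C : ℝ, 1 ≤ C ∧ ∀ m : ℕ, 1 ≤ m →
      (∑' k : ℤ, highPart vth f m k ^ 2) + (m : ℝ) ^ 2 *
        ∑' k : ℤ, (highPart vth f m k - highPart vth f m (k - 1)) ^ 2 ≤
          C * (maskWeight r κ m ^ 2 * m) := by
  obtain ⟨C, hC, hb⟩ := exists_highPart_bound hr hf hv
  refine ⟨2 * (C ^ 2 * 17 * 8), by nlinarith, fun m hm => ?_⟩
  have hm1 : (1 : ℝ) ≤ m := by exact_mod_cast hm
  have hm0 : (0 : ℝ) < m := by linarith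
  have hwm := maskWeight_pos r κ hm1
  obtain ⟨hs, ht⟩ := summable_and_tsum_inv_sq_add_sq_le hm1
  -- The 17 is 16 + 1, from m² ≤ 16ν² and k² ≤ ν².
  set A := C ^ 2 * 17 * (maskWeight r κ m ^ 2 * m ^ 2) with hA
  have hA0 : 0 ≤ A := by positivity
  have key : ∀ (k : ℤ) (y : ℝ), |y| ≤ C * (maskWeight r κ m * m / max |(k : ℝ)| 1) →
      ((m : ℝ) ≤ 4 * max |(k : ℝ)| 1 ∨ y = 0) → y ^ 2 ≤ A * (1 / ((m : ℝ) ^ 2 + (k : ℝ) ^ 2)) := by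
    intro k y hy h
    rcases h with h | rfl
    · set ν := max |(k : ℝ)| 1
      have hν0 : 0 < ν := by positivity
      have hkν : |(k : ℝ)| ≤ ν := le_max_left _ _
      have h1 : (k : ℝ) ^ 2 ≤ ν ^ 2 := by rw [← sq_abs]; gcongr
      have h2 : (m : ℝ) ^ 2 ≤ (4 * ν) ^ 2 := by gcongr
      calc y ^ 2 = |y| ^ 2 := (sq_abs y).symm
        _ ≤ (C * (maskWeight r κ m * m / ν)) ^ 2 := by gcongr
        _ = C ^ 2 * (maskWeight r κ m ^ 2 * m ^ 2) * (1 / ν ^ 2) := by ring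
        _ ≤ C ^ 2 * (maskWeight r κ m ^ 2 * m ^ 2) * (17 / ((m : ℝ) ^ 2 + (k : ℝ) ^ 2)) := by
            gcongr ?_ * ?_
            rw [div_le_div_iff₀ (by positivity) (by positivity)]
            linarith
        _ = _ := by rw [hA]; ring
    · rw [zero_pow two_ne_zero]; positivity
  have hsum : ∀ y : ℤ → ℝ, (∀ k, y k ^ 2 ≤ A * (1 / ((m : ℝ) ^ 2 + (k : ℝ) ^ 2))) →
      ∑' k : ℤ, y k ^ 2 ≤ C ^ 2 * 17 * 8 * (maskWeight r κ m ^ 2 * m) := by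
    intro y hy
    have h1 : Summable fun k => y k ^ 2 :=
      Summable.of_nonneg_of_le (fun k => sq_nonneg _) hy (hs.mul_left A)
    calc _ ≤ ∑' k : ℤ, A * (1 / ((m : ℝ) ^ 2 + (k : ℝ) ^ 2)) :=
          h1.tsum_le_tsum hy (hs.mul_left A)
      _ = A * ∑' k : ℤ, 1 / ((m : ℝ) ^ 2 + (k : ℝ) ^ 2) := tsum_mul_left
      _ ≤ A * (8 / m) := by gcongr
      _ = _ := by rw [hA]; field_simp
  have h1 := hsum (fun k => highPart vth f m k) fun k => by
    obtain ⟨h1, -, h3⟩ := hb m hm k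
    exact key k _ h1 (h3.imp_right And.left)
  have h2 := hsum (fun k => m * (highPart vth f m k - highPart vth f m (k - 1))) fun k => by
    obtain ⟨-, h2, h3⟩ := hb m hm k
    refine key k _ ?_ (h3.imp_right fun h => by rw [h.2, mul_zero])
    rwa [abs_mul, abs_of_pos hm0]
  simp only [mul_pow, tsum_mul_left] at h2
  linarith

theorem summable_highPart {r κ : ℝ} {f vth : ℝ → ℝ} (hr : 1 < r) (hf : IsMask r κ f)
    (hv : IsCutoff vth) (m : ℕ) : Summable fun k : ℤ => highPart vth f m k := by
  obtain ⟨B, hB, hvb, -⟩ := hv.exists_bound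
  refine Summable.of_norm_bounded ((hf.summable hr).abs.mul_left (1 + B)) fun k => ?_
  rw [highPart, norm_mul, Real.norm_eq_abs, Real.norm_eq_abs]
  gcongr
  refine (abs_sub _ _).trans ?_
  rw [abs_one]
  linarith [hvb (k / m)]

/-- The `L¹`-norm of the kernel of the high frequency part. -/
theorem exists_integral_norm_highPart_le {r κ : ℝ} {f vth : ℝ → ℝ} (hr : 1 < r)
    (hf : IsMask r κ f) (hv : IsCutoff vth) :
    ∃ C : ℝ, 1 ≤ C ∧ ∀ m : ℕ, 1 ≤ m →
      ∫ x, ‖phi (highPart vth f m) x‖ ∂haar ≤ C * maskWeight r κ m := by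
  obtain ⟨C, hC, h⟩ := exists_sq_sum_highPart_le hr hf hv
  refine ⟨C + Real.pi, by linarith [Real.pi_pos], fun m hm => ?_⟩
  have hm1 : (1 : ℝ) ≤ m := by exact_mod_cast hm
  have hm0 : (0 : ℝ) < m := by linarith
  have hwm := maskWeight_pos r κ hm1
  -- With N = m this δ balances Bernstein's two terms: both become multiples of w(m).
  have hδ : 0 < 1 / (maskWeight r κ m * m) := by positivity
  refine (integral_norm_phi_le (summable_highPart hr hf hv m) hm0 hδ).trans ?_
  calc _ ≤ 1 / (maskWeight r κ m * m) * (C * (maskWeight r κ m ^ 2 * m)) +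
        Real.pi / (1 / (maskWeight r κ m * m) * m) := by
        gcongr
        exact h m hm
    _ = _ := by field_simp

/-! ### Sampling of characters and aliasing. -/

theorem summable_exp_neg_mul_abs_int {s : ℝ} (hs : 0 < s) :
    Summable fun k : ℤ => Real.exp (-(s * |(k : ℝ)|)) := by
  have h : Summable fun n : ℕ => Real.exp (-(s * (n : ℝ))) := by
    have := summable_geometric_of_lt_one (Real.exp_pos (-s)).le (Real.exp_lt_one_iff.2 (by linarith))
    refine this.congr fun n => ?_
    rw [← Real.exp_nat_mul]
    congr 1; ring
  refine Summable.of_nat_of_neg ?_ ?_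
  · simpa using h
  · simpa using h

theorem fourier_node (m k : ℕ) (l : ℤ) :
    fourier l (node m k) =
      Complex.exp (2 * Real.pi * Complex.I * l / (2 * m + 1)) ^ k := by
  rw [node, fourier_coe_apply, ← Complex.exp_nat_mul]
  congr 1
  have h1 : (Real.pi : ℂ) ≠ 0 := by exact_mod_cast Real.pi_ne_zero
  have h2 : (2 * (m : ℂ) + 1) ≠ 0 := by exact_mod_cast Nat.succ_ne_zero (2 * m)
  push_cast
  field_simp

/-- Orthogonality of the characters on the nodes. -/
theorem sum_fourier_node (m : ℕ) (l : ℤ) :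
    ∑ k ∈ Finset.range (2 * m + 1), fourier l (node m k) =
      if ((2 * m + 1 : ℕ) : ℤ) ∣ l then 2 * (m : ℂ) + 1 else 0 := by
  have h2 : (2 * (m : ℂ) + 1) ≠ 0 := by exact_mod_cast Nat.succ_ne_zero (2 * m)
  have h3 : (2 * Real.pi * Complex.I : ℂ) ≠ 0 := Complex.two_pi_I_ne_zero
  simp only [fourier_node]
  set z := Complex.exp (2 * Real.pi * Complex.I * l / (2 * m + 1)) with hz
  have hz1 : z = 1 ↔ ((2 * m + 1 : ℕ) : ℤ) ∣ l := by
    rw [hz, Complex.exp_eq_one_iff]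
    constructor
    · rintro ⟨n, hn⟩
      refine ⟨n, ?_⟩
      rw [div_eq_iff h2] at hn
      have : (l : ℂ) = (2 * m + 1) * n := by
        apply mul_left_cancel₀ h3
        rw [hn]; ring
      exact_mod_cast this
    · rintro ⟨n, rfl⟩
      refine ⟨n, ?_⟩
      push_cast
      field_simp
  split_ifs with h
  · rw [hz1.2 h]
    simp
  · have hz' : z ≠ 1 := fun h' => h (hz1.1 h')
    have hzN : z ^ (2 * m + 1) = 1 := by
      rw [hz, ← Complex.exp_nat_mul, Complex.exp_eq_one_iff]
      refine ⟨l, ?_⟩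
      push_cast
      field_simp
    rw [geom_sum_eq hz', hzN, sub_self, zero_div]

/-- The sampling operator applied to the character `e^{ijx}`. -/
def sample (beta : ℝ → ℝ) (m : ℕ) (j : ℤ) (x : Torus) : ℂ :=
  (1 / (2 * (m : ℂ) + 1)) * ∑ k ∈ Finset.range (2 * m + 1),
    fourier j (node m k) * phi beta (x - node m k)

/-- After the sums are interchanged, orthogonality on the nodes keeps exactly the frequencies
congruent to j modulo 2m + 1. -/
theorem sample_eq_tsum {beta : ℝ → ℝ} (h : Summable fun k : ℤ => beta (k : ℝ)) (m : ℕ) (j : ℤ)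
    (x : Torus) : sample beta m j x =
      ∑' l : ℤ, ((beta ((j + l * (2 * m + 1 : ℕ) : ℤ) : ℝ) : ℝ) : ℂ) *
        fourier (j + l * (2 * m + 1 : ℕ)) x := by
  have h2 : (2 * (m : ℂ) + 1) ≠ 0 := by exact_mod_cast Nat.succ_ne_zero (2 * m)
  have hN : ((2 * m + 1 : ℕ) : ℤ) ≠ 0 := by exact_mod_cast Nat.succ_ne_zero (2 * m)
  set N : ℤ := ((2 * m + 1 : ℕ) : ℤ) with hNdef
  have h1 : sample beta m j x = ∑' n : ℤ, if N ∣ j - n then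
      ((beta (n : ℝ) : ℝ) : ℂ) * fourier n x else 0 := by
    have hs : ∀ k ∈ Finset.range (2 * m + 1), Summable fun n : ℤ =>
        fourier j (node m k) * (((beta (n : ℝ) : ℝ) : ℂ) * fourier n (x - node m k)) :=
      fun k _ => (summable_phi h _).mul_left _
    rw [sample]
    simp only [phi, ← tsum_mul_left (f := fun n : ℤ => ((beta (n : ℝ) : ℝ) : ℂ) * _)]
    rw [← Summable.tsum_finsetSum hs, ← tsum_mul_left]
    refine tsum_congr fun n => ?_
    have e : ∀ k ∈ Finset.range (2 * m + 1),
        fourier j (node m k) * (((beta (n : ℝ) : ℝ) : ℂ) * fourier n (x - node m k)) =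
          ((beta (n : ℝ) : ℝ) : ℂ) * fourier n x * fourier (j - n) (node m k) := by
      intro k _
      rw [fourier_sub_apply, sub_eq_add_neg j n, fourier_add]
      ring
    rw [Finset.sum_congr rfl e, ← Finset.mul_sum, sum_fourier_node]
    split_ifs
    · field_simp
    · simp
  have hinj : Function.Injective fun l : ℤ => j + l * N := fun a b hab => by
    simpa [hN] using hab
  rw [h1, ← hinj.tsum_eq]
  · refine tsum_congr fun l => ?_
    have : N ∣ j - (j + l * N) := ⟨-l, by ring⟩
    rw [if_pos this]
  · intro n hn
    rw [Function.mem_support] at hn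
    have hd : N ∣ j - n := by
      by_contra hd
      exact hn (if_neg hd)
    obtain ⟨l, hl⟩ := hd
    refine ⟨-l, ?_⟩
    simp only
    linarith

theorem IsExponentType.pos {beta : ℝ → ℝ} (h : IsExponentType beta) (t : ℝ) : 0 < beta t := by
  obtain ⟨s, hs, F, hF, -, hb⟩ := h
  rw [hb]
  exact mul_pos (Real.exp_pos _) (hF _ (abs_nonneg _))

/-- Monotonicity of `F` makes the decay relative to any earlier value of β, so errors can be
measured in units of β(j). -/
theorem IsExponentType.exists_decay {beta : ℝ → ℝ} (h : IsExponentType beta) :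
    ∃ s : ℝ, 0 < s ∧ ∀ t u : ℝ, |t| ≤ |u| → beta u ≤ beta t * Real.exp (-(s * (|u| - |t|))) := by
  obtain ⟨s, hs, F, hF, ha, hb⟩ := h
  refine ⟨s, hs, fun t u htu => ?_⟩
  rw [hb, hb]
  have h1 : F |u| ≤ F |t| := ha (abs_nonneg t) (abs_nonneg u) htu
  calc Real.exp (-(s * |u|)) * F |u| ≤ Real.exp (-(s * |u|)) * F |t| := by gcongr
    _ = (Real.exp (-(s * |t|)) * Real.exp (-(s * (|u| - |t|)))) * F |t| := by
        rw [← Real.exp_add]; congr 2; ring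
    _ = _ := by ring

theorem IsExponentType.summable {beta : ℝ → ℝ} (h : IsExponentType beta) :
    Summable fun k : ℤ => beta (k : ℝ) := by
  obtain ⟨s, hs, hd⟩ := h.exists_decay
  refine Summable.of_nonneg_of_le (fun k => (h.pos _).le) (fun k => ?_)
    ((summable_exp_neg_mul_abs_int hs).mul_left (beta 0))
  simpa using hd 0 k (by simp)

/-- Sampling reproduces the low characters up to an aliasing error. -/
theorem IsExponentType.exists_sample_sub_le {beta : ℝ → ℝ} (h : IsExponentType beta) :
    ∃ s C : ℝ, 0 < s ∧ 0 ≤ C ∧ ∀ (m : ℕ) (j : ℤ), |j| ≤ m → ∀ x,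
      ‖sample beta m j x - beta j * fourier j x‖ ≤
        C * (beta j * Real.exp (-(2 * s * (m - |(j : ℝ)|)))) := by
  obtain ⟨s, hs, hd⟩ := h.exists_decay
  have hse := summable_exp_neg_mul_abs_int hs
  refine ⟨s, Real.exp s * ∑' l : ℤ, Real.exp (-(s * |(l : ℝ)|)), hs, by positivity,
    fun m j hj x => ?_⟩
  have hj' : |(j : ℝ)| ≤ m := by exact_mod_cast hj
  have hbj := h.pos j
  -- The factor `Real.exp s` compensates for the decay in |l| - 1 rather than |l|.
  set A := beta j * Real.exp (-(2 * s * (m - |(j : ℝ)|))) * Real.exp s with hA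
  have hterm : ∀ l : ℤ, l ≠ 0 → beta ((j + l * (2 * m + 1 : ℕ) : ℤ) : ℝ) ≤
      A * Real.exp (-(s * |(l : ℝ)|)) := by
    intro l hl
    have hl1 : 1 ≤ |(l : ℝ)| := by
      have : 1 ≤ |l| := Int.one_le_abs hl
      exact_mod_cast this
    have h1 : |(l : ℝ)| * (2 * m + 1) - |(j : ℝ)| ≤ |((j + l * (2 * m + 1 : ℕ) : ℤ) : ℝ)| := by
      have h2 : (l : ℝ) * (2 * m + 1) = ((j + l * (2 * m + 1 : ℕ) : ℤ) : ℝ) - j := by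
        push_cast; ring
      have h3 : |(l : ℝ)| * (2 * m + 1) = |(l : ℝ) * (2 * m + 1)| := by
        rw [abs_mul, abs_of_pos (by positivity : (0 : ℝ) < 2 * m + 1)]
      rw [h3, h2]
      linarith [abs_sub ((j + l * (2 * m + 1 : ℕ) : ℤ) : ℝ) (j : ℝ)]
    have hm0 : (0 : ℝ) ≤ m := m.cast_nonneg
    -- One period already yields the gap 2(m - |j|) + 1; each further one adds 2m + 1 ≥ 1, which is
    -- enough for summability over l.
    have h4 : 2 * (m - |(j : ℝ)|) + (|(l : ℝ)| - 1) ≤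
        |((j + l * (2 * m + 1 : ℕ) : ℤ) : ℝ)| - |(j : ℝ)| := by nlinarith
    refine (hd j _ (by linarith)).trans ?_
    rw [hA, mul_assoc, mul_assoc, ← Real.exp_add, ← Real.exp_add]
    gcongr
    nlinarith
  have hsum : Summable fun l : ℤ => ((beta ((j + l * (2 * m + 1 : ℕ) : ℤ) : ℝ) : ℝ) : ℂ) *
      fourier (j + l * (2 * m + 1 : ℕ)) x := by
    have hinj : Function.Injective fun l : ℤ => j + l * (2 * m + 1 : ℕ) := fun a b hab => by
      have hN : ((2 * m + 1 : ℕ) : ℤ) ≠ 0 := by exact_mod_cast Nat.succ_ne_zero (2 * m)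
      exact mul_right_cancel₀ hN (add_left_cancel hab)
    exact (summable_phi h.summable x).comp_injective hinj
  rw [sample_eq_tsum h.summable, hsum.tsum_eq_add_tsum_ite 0]
  simp only [zero_mul, add_zero, add_sub_cancel_left]
  have hle : ∀ l : ℤ, ‖(if l = 0 then 0 else ((beta ((j + l * (2 * m + 1 : ℕ) : ℤ) : ℝ) : ℝ) : ℂ) *
      fourier (j + l * (2 * m + 1 : ℕ)) x)‖ ≤ A * Real.exp (-(s * |(l : ℝ)|)) := by
    intro l
    split_ifs with hl
    · rw [norm_zero]; positivity
    · rw [norm_mul, norm_fourier_apply, mul_one, Complex.norm_real, Real.norm_eq_abs,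
        abs_of_pos (h.pos _)]
      exact hterm l hl
  refine (tsum_of_norm_bounded (hse.mul_left A).hasSum hle).trans_eq ?_
  rw [tsum_mul_left, hA]
  ring

theorem exists_rpow_le_mul_exp {M s : ℝ} (hs : 0 < s) :
    ∃ C : ℝ, 0 < C ∧ ∀ d : ℝ, 0 ≤ d → (1 + d) ^ M ≤ C * Real.exp (s * d) := by
  obtain ⟨n, hn⟩ := exists_nat_ge M
  refine ⟨n.factorial / s ^ n * Real.exp s, by positivity, fun d hd => ?_⟩
  calc (1 + d) ^ M ≤ (1 + d) ^ (n : ℝ) :=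
        Real.rpow_le_rpow_of_exponent_le (by linarith) hn
    _ = n.factorial / s ^ n * ((s * (1 + d)) ^ n / n.factorial) := by
        rw [Real.rpow_natCast, mul_pow]
        have := Nat.factorial_pos n
        field_simp
    _ ≤ n.factorial / s ^ n * Real.exp (s * (1 + d)) := by
        gcongr
        exact Real.pow_div_factorial_le_exp _ (by positivity) n
    _ = _ := by rw [mul_assoc, ← Real.exp_add]; congr 2; ring

/-- Going left from m, the weight grows at most like (m/|j|)^(r+1), which half of the exponential
absorbs; the other half is a convergent geometric series in the distance m - |j|. -/
theorem IsMask.exists_sum_exp_le {r κ : ℝ} {f : ℝ → ℝ} (hr : 0 < r) (hf : IsMask r κ f) {s : ℝ}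
    (hs : 0 < s) : ∃ C : ℝ, 0 < C ∧ ∀ m : ℕ, 1 ≤ m →
      ∑ j ∈ Finset.Icc (-(m : ℤ)) m, |f j| * Real.exp (-(2 * s * (m - |(j : ℝ)|))) ≤
        C * maskWeight r κ m := by
  obtain ⟨C, hC, hb⟩ := hf.exists_int_bound hr
  obtain ⟨C₂, hC₂, hp⟩ := exists_maskWeight_le_of_ge r κ
  obtain ⟨D, hD, hexp⟩ := exists_rpow_le_mul_exp (M := r + 1) hs
  have hse := summable_exp_neg_mul_abs_int hs
  set T := ∑' l : ℤ, Real.exp (-(s * |(l : ℝ)|)) with hT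
  have hT0 : 0 ≤ T := by positivity
  refine ⟨C * C₂ * D * (T + T) + 1, by positivity, fun m hm => ?_⟩
  have hm1 : (1 : ℝ) ≤ m := by exact_mod_cast hm
  have hwm := maskWeight_pos r κ hm1
  have hterm : ∀ j ∈ Finset.Icc (-(m : ℤ)) m,
      |f j| * Real.exp (-(2 * s * (m - |(j : ℝ)|))) ≤ C * C₂ * D * maskWeight r κ m *
        (Real.exp (-(s * |((m - j : ℤ) : ℝ)|)) + Real.exp (-(s * |((m + j : ℤ) : ℝ)|))) := by
    intro j hj
    have hj1 : |(j : ℝ)| ≤ m := by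
      have : |j| ≤ m := abs_le.2 (Finset.mem_Icc.1 hj)
      exact_mod_cast this
    have hj2 := abs_le.1 hj1
    set ν := max |(j : ℝ)| 1 with hν
    have hν1 : 1 ≤ ν := le_max_right _ _
    have hν0 : 0 < ν := by linarith
    -- For j ≠ 0 this amounts to (m - |j|)(|j| - 1) ≥ 0.
    have hmν : m / ν ≤ 1 + (m - |(j : ℝ)|) := by
      rw [div_le_iff₀ hν0]
      have : |(j : ℝ)| ≤ ν := le_max_left _ _
      rcases eq_or_ne j 0 with rfl | h0
      · have : ν = 1 := by rw [hν]; simp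
        rw [this]; simp
      · have h1 : 1 ≤ |(j : ℝ)| := by
          have : 1 ≤ |j| := Int.one_le_abs h0
          exact_mod_cast this
        have : ν = |(j : ℝ)| := max_eq_left h1
        rw [this]
        nlinarith
    have hd0 : 0 ≤ m - |(j : ℝ)| := by linarith
    have h1 : |f j| ≤ C * (C₂ * (D * Real.exp (s * (m - |(j : ℝ)|))) * maskWeight r κ m) := by
      refine (hb j).1.trans ?_
      gcongr
      refine (hp ν m hν1 (max_le hj1 hm1)).trans ?_
      gcongr
      refine le_trans ?_ (hexp _ hd0)
      gcongr
    -- Adding the terms for both signs of j removes the inner absolute value, so each sum is part of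
    -- a translated or reflected full series.
    have h2 : Real.exp (-(s * (m - |(j : ℝ)|))) ≤
        Real.exp (-(s * |((m - j : ℤ) : ℝ)|)) + Real.exp (-(s * |((m + j : ℤ) : ℝ)|)) := by
      push_cast
      rw [abs_of_nonneg (by linarith : (0 : ℝ) ≤ m - j), abs_of_nonneg (by linarith : (0 : ℝ) ≤ m + j)]
      rcases abs_choice (j : ℝ) with h | h <;> rw [h]
      · linarith [Real.exp_pos (-(s * (m + (j : ℝ))))]
      · rw [sub_neg_eq_add]
        linarith [Real.exp_pos (-(s * (m - (j : ℝ))))]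
    calc _ ≤ C * (C₂ * (D * Real.exp (s * (m - |(j : ℝ)|))) * maskWeight r κ m) *
          Real.exp (-(2 * s * (m - |(j : ℝ)|))) := by gcongr
      _ = C * C₂ * D * maskWeight r κ m *
          (Real.exp (s * (m - |(j : ℝ)|)) * Real.exp (-(2 * s * (m - |(j : ℝ)|)))) := by ring
      _ = C * C₂ * D * maskWeight r κ m * Real.exp (-(s * (m - |(j : ℝ)|))) := by
          rw [← Real.exp_add]; congr 2; ring
      _ ≤ _ := by gcongr
  have hs1 : ∑ j ∈ Finset.Icc (-(m : ℤ)) m, Real.exp (-(s * |((m - j : ℤ) : ℝ)|)) ≤ T := by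
    rw [hT, ← (Equiv.subLeft (m : ℤ)).tsum_eq]
    exact ((Equiv.subLeft (m : ℤ)).summable_iff.2 hse).sum_le_tsum _
      fun j _ => (Real.exp_pos _).le
  have hs2 : ∑ j ∈ Finset.Icc (-(m : ℤ)) m, Real.exp (-(s * |((m + j : ℤ) : ℝ)|)) ≤ T := by
    rw [hT, ← (Equiv.addLeft (m : ℤ)).tsum_eq]
    exact ((Equiv.addLeft (m : ℤ)).summable_iff.2 hse).sum_le_tsum _
      fun j _ => (Real.exp_pos _).le
  refine (Finset.sum_le_sum hterm).trans ?_
  rw [← Finset.mul_sum, Finset.sum_add_distrib]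
  calc _ ≤ C * C₂ * D * maskWeight r κ m * (T + T) := by gcongr
    _ ≤ _ := by linarith

/-! ### The operators as finite sums over characters, and the aliasing error. -/

theorem kernelH_eq_phi (vth lam beta : ℝ → ℝ) (m : ℕ) :
    kernelH vth lam beta m = phi fun t => vth (t / m) * (lam t / beta t) := rfl

theorem IsCutoff.eq_zero_of_notMem {vth : ℝ → ℝ} (hv : IsCutoff vth) {m : ℕ} (hm : 1 ≤ m) {k : ℤ}
    (hk : k ∉ Finset.Icc (-(m : ℤ)) m) : vth ((k : ℝ) / m) = 0 := by
  refine hv.2.2 _ fun h => hk ?_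
  have hm0 : (0 : ℝ) < m := by exact_mod_cast hm
  have h1 := abs_lt.2 h
  rw [abs_div, abs_of_pos hm0, div_lt_one hm0] at h1
  have h2 : |k| < (m : ℤ) := by exact_mod_cast h1
  exact Finset.mem_Icc.2 ⟨(abs_lt.1 h2).1.le, (abs_lt.1 h2).2.le⟩

theorem opV_eq_sum {vth : ℝ → ℝ} (hv : IsCutoff vth) (lam beta : ℝ → ℝ) {m : ℕ} (hm : 1 ≤ m)
    {g : Torus → ℂ} (hg : Integrable g haar) (x : Torus) :
    opV vth lam beta m g x = ∑ j ∈ Finset.Icc (-(m : ℤ)) m,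
      ((vth ((j : ℝ) / m) * (lam j / beta j) : ℝ) : ℂ) * fourierCoeff g j * fourier j x := by
  have h0 : ∀ k ∉ Finset.Icc (-(m : ℤ)) m, vth ((k : ℝ) / m) * (lam k / beta k) = 0 :=
    fun k hk => by rw [hv.eq_zero_of_notMem hm hk, zero_mul]
  have hs : Summable fun k : ℤ => vth ((k : ℝ) / m) * (lam k / beta k) :=
    summable_of_ne_finset_zero h0
  rw [opV, kernelH_eq_phi, conv_phi (mu := fun t => vth (t / m) * (lam t / beta t)) hs hg]
  refine tsum_eq_sum fun k hk => ?_
  rw [h0 k hk, Complex.ofReal_zero, zero_mul, zero_mul]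

theorem opQGen_eq_sum {vth : ℝ → ℝ} (hv : IsCutoff vth) (lam beta : ℝ → ℝ) {m : ℕ} (hm : 1 ≤ m)
    {g : Torus → ℂ} (hg : Integrable g haar) (x : Torus) :
    opQGen vth lam beta m g x = ∑ j ∈ Finset.Icc (-(m : ℤ)) m,
      ((vth ((j : ℝ) / m) * (lam j / beta j) : ℝ) : ℂ) * fourierCoeff g j * sample beta m j x := by
  simp only [opQGen, sample, opV_eq_sum hv lam beta hm hg, Finset.sum_mul, Finset.mul_sum]
  rw [Finset.sum_comm]
  refine Finset.sum_congr rfl fun j _ => Finset.sum_congr rfl fun k _ => ?_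
  ring

/-- This low frequency part is the polynomial that `opQGen` would return if sampling had no
aliasing. -/
theorem conv_phi_sub_conv_highPart {r κ : ℝ} {lam vth : ℝ → ℝ} (hr : 1 < r)
    (hlam : IsMask r κ lam) (hv : IsCutoff vth) {m : ℕ} (hm : 1 ≤ m)
    {g : Torus → ℂ} (hg : Integrable g haar) (x : Torus) :
    conv (phi lam) g x - conv (phi (highPart vth lam m)) g x =
      ∑ j ∈ Finset.Icc (-(m : ℤ)) m,
        ((vth ((j : ℝ) / m) * lam j : ℝ) : ℂ) * fourierCoeff g j * fourier j x := by
  have h1 := hlam.summable hr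
  have h2 := summable_highPart hr hlam hv m
  rw [conv_phi h1 hg, conv_phi h2 hg,
    ← (summable_series h1 g x).tsum_sub (summable_series h2 g x)]
  have e : ∀ k : ℤ, ((lam k : ℝ) : ℂ) * fourierCoeff g k * fourier k x -
      ((highPart vth lam m k : ℝ) : ℂ) * fourierCoeff g k * fourier k x =
        ((vth ((k : ℝ) / m) * lam k : ℝ) : ℂ) * fourierCoeff g k * fourier k x := fun k => by
    rw [highPart]; push_cast; ring
  simp only [e]
  refine tsum_eq_sum fun k hk => ?_
  rw [hv.eq_zero_of_notMem hm hk, zero_mul, Complex.ofReal_zero, zero_mul, zero_mul]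

/-- The aliasing error of the sampling operator is uniformly small. -/
theorem exists_aliasing_le {r κ : ℝ} {lam vth beta : ℝ → ℝ} (hr : 1 < r)
    (hlam : IsMask r κ lam) (hv : IsCutoff vth) (hbeta : IsExponentType beta) :
    ∃ C : ℝ, 0 < C ∧ ∀ m : ℕ, 1 ≤ m → ∀ g : Torus → ℂ, Integrable g haar → ∀ x,
      ‖opQGen vth lam beta m g x -
        (conv (phi lam) g x - conv (phi (highPart vth lam m)) g x)‖ ≤
        C * maskWeight r κ m * ∫ t, ‖g t‖ ∂haar := by
  obtain ⟨B, hB, hvb, -⟩ := hv.exists_bound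
  obtain ⟨s, C, hs, hC, hsam⟩ := hbeta.exists_sample_sub_le
  obtain ⟨D, hD, hsum⟩ := hlam.exists_sum_exp_le (by linarith) hs
  refine ⟨B * C * D + 1, by positivity, fun m hm g hg x => ?_⟩
  have hwm : 0 < maskWeight r κ m := maskWeight_pos r κ (by exact_mod_cast hm)
  set G := ∫ t, ‖g t‖ ∂haar with hG
  have hG0 : 0 ≤ G := integral_nonneg fun t => norm_nonneg _
  rw [opQGen_eq_sum hv lam beta hm hg, conv_phi_sub_conv_highPart hr hlam hv hm hg,
    ← Finset.sum_sub_distrib]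
  have hterm : ∀ j ∈ Finset.Icc (-(m : ℤ)) m,
      ‖((vth ((j : ℝ) / m) * (lam j / beta j) : ℝ) : ℂ) * fourierCoeff g j * sample beta m j x -
        ((vth ((j : ℝ) / m) * lam j : ℝ) : ℂ) * fourierCoeff g j * fourier j x‖ ≤
      B * C * G * (|lam j| * Real.exp (-(2 * s * (m - |(j : ℝ)|)))) := by
    intro j hj
    have hb := hbeta.pos j
    have hb' : ((beta j : ℝ) : ℂ) ≠ 0 := by exact_mod_cast hb.ne'
    -- Since λ(j) = (λ(j)/β(j)) β(j), the sampling error factors out, and its factor β(j) cancels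
    -- the denominator.
    have e : ((vth ((j : ℝ) / m) * (lam j / beta j) : ℝ) : ℂ) * fourierCoeff g j *
          sample beta m j x -
        ((vth ((j : ℝ) / m) * lam j : ℝ) : ℂ) * fourierCoeff g j * fourier j x =
        ((vth ((j : ℝ) / m) * (lam j / beta j) : ℝ) : ℂ) * fourierCoeff g j *
          (sample beta m j x - beta j * fourier j x) := by
      push_cast
      field_simp
    rw [e, norm_mul, norm_mul, Complex.norm_real, Real.norm_eq_abs, abs_mul, abs_div,
      abs_of_pos hb]
    calc _ ≤ B * (|lam j| / beta j) * G *
          (C * (beta j * Real.exp (-(2 * s * (m - |(j : ℝ)|))))) := by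
          gcongr
          · exact hvb _
          · exact norm_fourierCoeff_le j
          · exact hsam m j (abs_le.2 (Finset.mem_Icc.1 hj)) x
      _ = _ := by field_simp
  refine (norm_sum_le_of_le _ hterm).trans ?_
  rw [← Finset.mul_sum]
  calc _ ≤ B * C * G * (D * maskWeight r κ m) := by
        gcongr
        exact hsum m hm
    _ = B * C * D * maskWeight r κ m * G := by ring
    _ ≤ _ := by gcongr; linarith

/-! ### The error estimate in L^p. -/

theorem continuous_opQGen (vth lam : ℝ → ℝ) {beta : ℝ → ℝ} (hbeta : IsExponentType beta)
    (m : ℕ) (g : Torus → ℂ) : Continuous (opQGen vth lam beta m g) := by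
  have := continuous_phi hbeta.summable
  unfold opQGen
  fun_prop

theorem ofReal_integral_norm_le_eLpNorm {p : ℝ≥0∞} (hp : 1 ≤ p) {g : Torus → ℂ}
    (hg : Integrable g haar) :
    ENNReal.ofReal (∫ t, ‖g t‖ ∂haar) ≤ eLpNorm g p haar := by
  rw [ofReal_integral_norm_eq_lintegral_enorm hg, ← eLpNorm_one_eq_lintegral_enorm]
  exact eLpNorm_le_eLpNorm_of_exponent_le hp hg.1

/-- The error estimate in terms of the generator. -/
theorem exists_eLpNorm_sub_opQGen_le {r κ : ℝ} {lam vth beta : ℝ → ℝ} (hr : 1 < r)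
    (hlam : IsMask r κ lam) (hv : IsCutoff vth) (hbeta : IsExponentType beta) :
    ∃ C : ℝ, 0 < C ∧ ∀ p : ℝ≥0∞, 1 ≤ p → ∀ m : ℕ, 1 ≤ m → ∀ g : Torus → ℂ, MemLp g p haar →
      eLpNorm (conv (phi lam) g - opQGen vth lam beta m g) p haar ≤
        ENNReal.ofReal (C * maskWeight r κ m) * eLpNorm g p haar := by
  obtain ⟨C₁, hC₁, h₁⟩ := exists_integral_norm_highPart_le hr hlam hv
  obtain ⟨C₂, hC₂, h₂⟩ := exists_aliasing_le hr hlam hv hbeta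
  refine ⟨C₁ + C₂, by linarith, fun p hp m hm g hgp => ?_⟩
  have hg : Integrable g haar := hgp.integrable hp
  have hwm : 0 < maskWeight r κ m := maskWeight_pos r κ (by exact_mod_cast hm)
  have hφ := summable_highPart hr hlam hv m
  set u := conv (phi (highPart vth lam m)) g with hu
  have huc : Continuous u := continuous_conv_phi hφ hg
  have hlc : Continuous (conv (phi lam) g) := continuous_conv_phi (hlam.summable hr) hg
  set R := opQGen vth lam beta m g - (conv (phi lam) g - u) with hR
  have hRc : Continuous R := (continuous_opQGen vth lam hbeta m g).sub (hlc.sub huc)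
  have e : conv (phi lam) g - opQGen vth lam beta m g = u - R := by
    rw [hR]; abel
  have hu1 : eLpNorm u p haar ≤ ENNReal.ofReal (C₁ * maskWeight r κ m) * eLpNorm g p haar := by
    refine (eLpNorm_conv_le hp (continuous_phi hφ) hg.1).trans ?_
    rw [← ofReal_integral_norm_eq_lintegral_enorm
      (integrable_of_continuous (continuous_phi hφ))]
    gcongr
    exact h₁ m hm
  have hR1 : eLpNorm R p haar ≤ ENNReal.ofReal (C₂ * maskWeight r κ m) * eLpNorm g p haar := by
    -- The aliasing error is bounded uniformly; on a probability space that also bounds its L^p-norm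
    -- for every p.
    refine (eLpNorm_le_of_ae_bound (Filter.Eventually.of_forall (h₂ m hm g hg))).trans ?_
    rw [measure_univ, ENNReal.one_rpow, one_mul, ENNReal.ofReal_mul (by positivity)]
    gcongr
    exact ofReal_integral_norm_le_eLpNorm hp hg
  rw [e]
  refine (eLpNorm_sub_le huc.aestronglyMeasurable hRc.aestronglyMeasurable hp).trans ?_
  rw [add_mul, ENNReal.ofReal_add (by positivity) (by positivity), add_mul]
  exact add_le_add hu1 hR1

end TranslateApprox

end

theorem mainTheorem7
    (p : ENNReal) (hp : 1 ≤ p) (r : ℝ) (hr : 1 < r) (κ : ℤ)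
    (vth lam beta : ℝ → ℝ)
    (hvth : TranslateApprox.IsCutoff vth)
    (hlam : TranslateApprox.IsMask r (κ : ℝ) lam) (hlam0 : ∀ x, lam x ≠ 0)
    (hbeta : TranslateApprox.IsExponentType beta) :
    ∃ c : ℝ, 0 < c ∧ ∀ f ∈ TranslateApprox.HSpace lam p, ∀ m : ℕ, 1 ≤ m →
      MeasureTheory.eLpNorm (f - TranslateApprox.opQ vth lam beta p m f) p TranslateApprox.haar ≤
        ENNReal.ofReal (c * (m : ℝ) ^ (-r) * Real.log ((m : ℝ) + 1) ^ (-κ)) *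
          TranslateApprox.HNorm lam p f := by
  obtain ⟨C, hC, h⟩ := TranslateApprox.exists_eLpNorm_sub_opQGen_le hr hlam hvth hbeta
  refine ⟨C, hC, fun f hf m hm => ?_⟩
  obtain ⟨hg, hfg⟩ := TranslateApprox.represents_generator hf
  -- The logarithm carries an integer power in the statement and a real power in `maskWeight`.
  have e : C * (m : ℝ) ^ (-r) * Real.log ((m : ℝ) + 1) ^ (-κ) =
      C * TranslateApprox.maskWeight r κ m := by
    rw [TranslateApprox.maskWeight, mul_assoc, ← Int.cast_neg, Real.rpow_intCast]
  rw [e, MeasureTheory.eLpNorm_congr_ae (hfg.sub Filter.EventuallyEq.rfl)]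
  exact h p hp m hm _ hg
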